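/- Let $\mathcal C$ be a (locally small) category, and let $\mathrm{pro}\text{-}\mathcal C$ be the category whose objects are the functors $X\colon I\to\mathcal C$ with $I$ a small cofiltered category, with morphisms $$\mathrm{Hom}(X,Y)=\lim_s\operatorname{colim}_t\mathrm{Hom}_{\mathcal C}(X_t,Y_s).$$ A level representation of a diagram $X\colon D\to\mathrm{pro}\text{-}\mathcal C$ consists of a small cofiltered category $I$, a functor $\tilde X\colon D\times I\to\mathcal C$, and isomorphisms from $X^d$ to the pro-objects $s\mapsto\tilde X^d_s$ that are natural in $d$ with respect to the levelwise maps. A category is loopless if it has no non-identity endomorphisms. Theorem. Cofiltered limits commute with finite colimits in $\mathrm{pro}\text{-}\mathcal C$. In detail: 1. All small cofiltered limits exist in $\mathrm{pro}\text{-}\mathcal C$. If $\mathcal C$ has finite colimits, so does $\mathrm{pro}\text{-}\mathcal C$; more precisely, if $B$ is a finite loopless category and $\mathcal C$ has colimits of shape $B$, then $\mathrm{pro}\text{-}\mathcal C$ has colimits of shape $B$. 2. Let $A$ be a small cofiltered category, $B$ a finite category, and $X\colon A\times B\to\mathrm{pro}\text{-}\mathcal C$, $(a,b)\mapsto X^{a,b}$,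 a functor such that $\operatorname{colim}_b X^{a,b}$ exists in $\mathrm{pro}\text{-}\mathcal C$ for every $a$. Then $\operatorname{colim}_b\lim_a X^{a,b}$ exists, and the canonical map $$\operatorname{colim}_b\lim_a X^{a,b}\longrightarrow\lim_a\operatorname{colim}_b X^{a,b}$$ is an isomorphism. 3. Let $A$, $B$, $X$ be as above (without the assumption on colimits in $\mathrm{pro}\text{-}\mathcal C$), and let $\tilde X\colon A\times B\times I\to\mathcal C$ be a level representation of $X$ for which all colimits $\operatorname{colim}_b\tilde X^{a,b}_s$ exist in $\mathcal C$. Then the pro-object $$A\times I\to\mathcal C,\qquad (a,s)\mapsto\operatorname{colim}_b\tilde X^{a,b}_s,$$ is both $\lim_a\operatorname{colim}_b X^{a,b}$ and $\operatorname{colim}_b\lim_a X^{a,b}$: for each $a$, $s\mapsto\operatorname{colim}_b\tilde X^{a,b}_s$ is $\operatorname{colim}_bX^{a,b}$; for each $b$, $(a,s)\mapsto\tilde X^{a,b}_s$ is $\lim_aX^{a,b}$; and these (co)limits are formed with the evident levelwise maps and projections, with respect to which the canonical map of part 2 is the identity. 4. Let $A$ be small cofiltered, $B$ finite and loopless, and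 $X\colon A\times B\to\mathrm{pro}\text{-}\mathcal C$ a functor. Then there are a directed partially ordered set $A'$, regarded as a cofiltered category in which each object is the source of only finitely many arrows, a functor $T\colon A'\to A$ that is cofinal for limits (initial), and a level representation $\tilde X\colon A'\times B\times I\to\mathcal C$ of $(a,b)\mapsto X^{T(a),b}$. If all $\operatorname{colim}_b\tilde X^{a,b}_s$ exist in $\mathcal C$, then $\lim_{a\in A}\operatorname{colim}_bX^{a,b}$ (whenever the inner colimits exist) and $\operatorname{colim}_b\lim_{a\in A}X^{a,b}$ are both isomorphic to the pro-object $A'\times I\to\mathcal C$, $(a,s)\mapsto\operatorname{colim}_b\tilde X^{a,b}_s$. -/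

import Mathlib

open CategoryTheory CategoryTheory.Limits

universe w v u w₁ w₂ u₁ u₂ u₃

namespace ProCategory

section Objects

/-- A pro-object of `C`: a functor to `C` from a small cofiltered category. -/
structure Pro (C : Type u) [Category.{v} C] : Type (max u (v + 1)) where
  Idx : Type v
  [cat : SmallCategory Idx]
  [cofiltered : IsCofiltered Idx]
  diag : Idx ⥤ C

attribute [instance] Pro.cat Pro.cofiltered

variable {C : Type u} [Category.{v} C]

/-- Two morphisms `X_t ⟶ c` and `X_t' ⟶ c` are identified when they agree after restriction
along some `r ⟶ t` and `r ⟶ t'`. -/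
def germSetoid (X : Pro C) (c : C) : Setoid (Σ t : X.Idx, (X.diag.obj t ⟶ c)) where
  r p q := ∃ (r : X.Idx) (a : r ⟶ p.1) (b : r ⟶ q.1),
    X.diag.map a ≫ p.2 = X.diag.map b ≫ q.2
  iseqv :=
    { refl := fun p => ⟨p.1, 𝟙 _, 𝟙 _, rfl⟩
      symm := fun ⟨r, a, b, h⟩ => ⟨r, b, a, h.symm⟩
      trans := by
        rintro p q p' ⟨r, a, b, h⟩ ⟨r', a', b', h'⟩
        obtain ⟨z, m, m', hz⟩ := IsCofiltered.cospan b a'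
        refine ⟨z, m ≫ a, m' ≫ b', ?_⟩
        rw [Functor.map_comp, Functor.map_comp, Category.assoc, Category.assoc, h, ← h',
          ← Category.assoc, ← Category.assoc, ← Functor.map_comp, ← Functor.map_comp, hz] }

/-- The filtered colimit `colim_t Hom_C (X_t, c)`. -/
def Germ (X : Pro C) (c : C) : Type v := Quotient (germSetoid X c)

/-- The class in `colim_t Hom_C (X_t, c)` of a morphism `X_t ⟶ c`. -/
def Germ.mk (X : Pro C) {c : C} (t : X.Idx) (f : X.diag.obj t ⟶ c) : Germ X c :=
  Quotient.mk (germSetoid X c) ⟨t, f⟩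

theorem Germ.ind {X : Pro C} {c : C} {P : Germ X c → Prop}
    (h : ∀ (t : X.Idx) (f : X.diag.obj t ⟶ c), P (Germ.mk X t f)) (x : Germ X c) : P x :=
  Quotient.ind (fun p => h p.1 p.2) x

theorem Germ.mk_eq_iff {X : Pro C} {c : C} {t t' : X.Idx} {f : X.diag.obj t ⟶ c}
    {f' : X.diag.obj t' ⟶ c} :
    Germ.mk X t f = Germ.mk X t' f' ↔
      ∃ (r : X.Idx) (a : r ⟶ t) (b : r ⟶ t'), X.diag.map a ≫ f = X.diag.map b ≫ f' :=
  Quotient.eq (r := germSetoid X c)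

theorem Germ.mk_map {X : Pro C} {c : C} {r t : X.Idx} (a : r ⟶ t) (f : X.diag.obj t ⟶ c) :
    Germ.mk X r (X.diag.map a ≫ f) = Germ.mk X t f :=
  Germ.mk_eq_iff.2 ⟨r, 𝟙 r, a, by simp⟩

/-- Functoriality of `colim_t Hom_C (X_t, c)` in `c`. -/
def Germ.push {X : Pro C} {c d : C} (x : Germ X c) (g : c ⟶ d) : Germ X d :=
  Quotient.lift (fun p : Σ t : X.Idx, (X.diag.obj t ⟶ c) => Germ.mk X p.1 (p.2 ≫ g))
    (by
      rintro p q ⟨r, a, b, h⟩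
      exact Germ.mk_eq_iff.2 ⟨r, a, b, by rw [← Category.assoc, h, Category.assoc]⟩) x

@[simp]
theorem Germ.push_mk {X : Pro C} {c d : C} (t : X.Idx) (f : X.diag.obj t ⟶ c) (g : c ⟶ d) :
    (Germ.mk X t f).push g = Germ.mk X t (f ≫ g) := rfl

@[simp]
theorem Germ.push_id {X : Pro C} {c : C} (x : Germ X c) : x.push (𝟙 c) = x := by
  induction x using Germ.ind with
  | h t f => simp

@[simp]
theorem Germ.push_push {X : Pro C} {c d e : C} (x : Germ X c) (g : c ⟶ d) (h : d ⟶ e) :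
    (x.push g).push h = x.push (g ≫ h) := by
  induction x using Germ.ind with
  | h t f => simp

/-- A morphism of pro-objects: an element of `lim_s colim_t Hom_C (X_t, Y_s)`. -/
@[ext]
structure Pro.Hom (X Y : Pro C) : Type v where
  toFun : ∀ s : Y.Idx, Germ X (Y.diag.obj s)
  compat : ∀ {s s' : Y.Idx} (f : s ⟶ s'), (toFun s).push (Y.diag.map f) = toFun s'

/-- Precomposition of a class in `colim_t Hom_C (Y_t, c)` with a morphism of pro-objects. -/
def Germ.pull {X Y : Pro C} (φ : Pro.Hom X Y) {c : C} (y : Germ Y c) : Germ X c :=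
  Quotient.lift (fun p : Σ t : Y.Idx, (Y.diag.obj t ⟶ c) => (φ.toFun p.1).push p.2)
    (by
      rintro p q ⟨r, a, b, h⟩
      rw [← φ.compat a, ← φ.compat b, Germ.push_push, Germ.push_push, h]) y

@[simp]
theorem Germ.pull_mk {X Y : Pro C} (φ : Pro.Hom X Y) {c : C} (t : Y.Idx)
    (f : Y.diag.obj t ⟶ c) : (Germ.mk Y t f).pull φ = (φ.toFun t).push f := rfl

theorem Germ.pull_push {X Y : Pro C} (φ : Pro.Hom X Y) {c d : C} (y : Germ Y c) (g : c ⟶ d) :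
    (y.push g).pull φ = (y.pull φ).push g := by
  induction y using Germ.ind with
  | h t f => simp

/-- The identity is represented by identities. -/
def Pro.Hom.id (X : Pro C) : Pro.Hom X X where
  toFun s := Germ.mk X s (𝟙 _)
  compat {s s'} f := by
    have h := Germ.mk_map (X := X) f (𝟙 (X.diag.obj s'))
    simpa using h

/-- Composition of pro-maps: if `ψ` at `s` is represented by `g : Y_t ⟶ Z_s` and `φ` at `t` is
represented by `f : X_r ⟶ Y_t`, then the composite at `s` is represented by `f ≫ g`. -/
def Pro.Hom.comp {X Y Z : Pro C} (φ : Pro.Hom X Y) (ψ : Pro.Hom Y Z) : Pro.Hom X Z where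
  toFun s := (ψ.toFun s).pull φ
  compat f := by rw [← Germ.pull_push, ψ.compat]

theorem Germ.pull_id {X : Pro C} {c : C} (x : Germ X c) : x.pull (Pro.Hom.id X) = x := by
  induction x using Germ.ind with
  | h t f => simp [Pro.Hom.id]

theorem Germ.pull_comp {X Y Z : Pro C} (φ : Pro.Hom X Y) (ψ : Pro.Hom Y Z) {c : C}
    (z : Germ Z c) : z.pull (φ.comp ψ) = (z.pull ψ).pull φ := by
  induction z using Germ.ind with
  | h t f => simp [Pro.Hom.comp, Germ.pull_push]

/-- The category pro-`C`. -/
instance : Category.{v} (Pro C) where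
  Hom := Pro.Hom
  id := Pro.Hom.id
  comp := Pro.Hom.comp
  id_comp φ := Pro.Hom.ext (funext fun s => Germ.pull_id (φ.toFun s))
  comp_id φ := Pro.Hom.ext (funext fun s => by simp [Pro.Hom.id, Pro.Hom.comp])
  assoc φ ψ χ := Pro.Hom.ext (funext fun s => Germ.pull_comp φ ψ (χ.toFun s))

end Objects

section Levels

variable {C : Type u} [Category.{v} C]

/-- For a small cofiltered `I`, the functor that views an `I`-diagram in `C` as a pro-object and
a natural transformation of such diagrams as a (levelwise) map of pro-objects. -/
def level (I : Type v) [SmallCategory I] [IsCofiltered I] : (I ⥤ C) ⥤ Pro C where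
  obj F := { Idx := I, diag := F }
  map {F G} η :=
    { toFun := fun s => Germ.mk { Idx := I, diag := F } s (η.app s)
      compat := fun {s s'} f => by
        have h := Germ.mk_map (X := { Idx := I, diag := F }) f (η.app s')
        simpa using h }
  map_id F := rfl
  map_comp η θ := rfl

/-- A level representation of a diagram `X` of pro-objects indexed by `D`: a small cofiltered
category `I`, a functor `D × I ⥤ C`, and isomorphisms from the `X d` to the pro-objects
`s ↦ diag (d, s)`, natural with respect to the levelwise maps. -/
structure LevelRep {D : Type u₁} [Category.{w₁} D] (X : D ⥤ Pro C) where
  I : Type v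
  [cat : SmallCategory I]
  [cofiltered : IsCofiltered I]
  diag : D × I ⥤ C
  iso : X ≅ Functor.curry.obj diag ⋙ level I

attribute [instance] LevelRep.cat LevelRep.cofiltered

/-- For `F : A × I ⥤ C` with `A` and `I` small cofiltered, the pro-object `F` indexed by `A × I`
projects to each of the pro-objects `s ↦ F (a, s)` indexed by `I`; at `s` the projection is
represented by the identity of `F (a, s)`. These projections form a cone. -/
def levelCone {A I : Type v} [SmallCategory A] [IsCofiltered A] [SmallCategory I]
    [IsCofiltered I] (F : A × I ⥤ C) : Cone (Functor.curry.obj F ⋙ level I) where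
  pt := (level (A × I)).obj F
  π :=
    { app := fun a =>
        { toFun := fun s => Germ.mk ((level (A × I)).obj F) (a, s) (𝟙 (F.obj (a, s)))
          compat := fun {s s'} f => by
            have h := Germ.mk_map (X := (level (A × I)).obj F)
              (show ((a, s) : A × I) ⟶ (a, s') from (𝟙 a, f)) (𝟙 (F.obj (a, s')))
            refine Eq.trans ?_ h
            exact congrArg (Germ.mk ((level (A × I)).obj F) ((a, s) : A × I))
              ((Category.id_comp _).trans (Category.comp_id _).symm) }
      naturality := fun {a a'} f => by
        refine Pro.Hom.ext (funext fun s => ?_)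
        have h := Germ.mk_map (X := (level (A × I)).obj F)
          (show ((a, s) : A × I) ⟶ (a', s) from (f, 𝟙 s)) (𝟙 (F.obj (a', s)))
        refine Eq.trans ?_ (h.symm.trans ?_)
        · exact Germ.pull_id (Germ.mk ((level (A × I)).obj F) ((a', s) : A × I) (𝟙 (F.obj (a', s))))
        · exact congrArg (Germ.mk ((level (A × I)).obj F) ((a, s) : A × I))
            ((Category.comp_id _).trans (Category.id_comp _).symm) }

end Levels

/-- A category without non-identity endomorphisms. -/
def IsLoopless (B : Type u₁) [Category.{w₁} B] : Prop := ∀ (b : B) (f : b ⟶ b), f = 𝟙 b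

section Iterated

variable {A : Type u₁} [Category.{w₁} A] {B : Type u₂} [Category.{w₂} B]
  {D : Type u₃} [Category.{w} D]

/-- Data for an iterated `lim_a colim_b X (a, b)`: a functor `a ↦ col a`, maps
`X (a, b) ⟶ col a` natural in `(a, b)`, and a cone over `col`. -/
structure LimColim (X : A × B ⥤ D) where
  col : A ⥤ D
  ι : X ⟶ CategoryTheory.Prod.fst A B ⋙ col
  cone : Cone col

/-- The cocone with vertex `col a` on the diagram `b ↦ X (a, b)`. -/
def LimColim.cocone {X : A × B ⥤ D} (P : LimColim X) (a : A) :
    Cocone ((Functor.curry.obj X).obj a) where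
  pt := P.col.obj a
  ι :=
    { app := fun b => P.ι.app (a, b)
      naturality := fun b b' f => by
        have h := P.ι.naturality (show ((a, b) : A × B) ⟶ (a, b') from (𝟙 a, f))
        refine h.trans ?_
        exact congrArg (fun k => P.ι.app (a, b) ≫ k) (P.col.map_id a) }

/-- The vertex of `P.cone` is `lim_a colim_b X (a, b)`. -/
def LimColim.IsUniversal {X : A × B ⥤ D} (P : LimColim X) : Prop :=
  (∀ a : A, Nonempty (IsColimit (P.cocone a))) ∧ Nonempty (IsLimit P.cone)

/-- Data for an iterated `colim_b lim_a X (a, b)`: a functor `b ↦ lim b`, maps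
`lim b ⟶ X (a, b)` natural in `(a, b)`, and a cocone on `lim`. -/
structure ColimLim (X : A × B ⥤ D) where
  lim : B ⥤ D
  π : CategoryTheory.Prod.snd A B ⋙ lim ⟶ X
  cocone : Cocone lim

/-- The cone with vertex `lim b` over the diagram `a ↦ X (a, b)`. -/
def ColimLim.cone {X : A × B ⥤ D} (Q : ColimLim X) (b : B) :
    Cone ((Functor.curry.obj (CategoryTheory.Prod.swap B A ⋙ X)).obj b) where
  pt := Q.lim.obj b
  π :=
    { app := fun a => Q.π.app (a, b)
      naturality := fun a a' f => by
        have h := Q.π.naturality (show ((a, b) : A × B) ⟶ (a', b) from (f, 𝟙 b))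
        refine Eq.trans ?_ h
        exact congrArg (fun k => k ≫ Q.π.app (a', b)) (Q.lim.map_id b).symm }

/-- The vertex of `Q.cocone` is `colim_b lim_a X (a, b)`. -/
def ColimLim.IsUniversal {X : A × B ⥤ D} (Q : ColimLim X) : Prop :=
  (∀ b : B, Nonempty (IsLimit (Q.cone b))) ∧ Nonempty (IsColimit Q.cocone)

/-- `f` is the canonical map `colim_b lim_a X (a, b) ⟶ lim_a colim_b X (a, b)`: for all `a` and
`b`, its composite with `lim_a X (a, b) ⟶ colim_b lim_a X (a, b)` and with
`lim_a colim_b X (a, b) ⟶ colim_b X (a, b)` is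
`lim_a X (a, b) ⟶ X (a, b) ⟶ colim_b X (a, b)`. -/
def IsComparison {X : A × B ⥤ D} (Q : ColimLim X) (P : LimColim X)
    (f : Q.cocone.pt ⟶ P.cone.pt) : Prop :=
  ∀ (a : A) (b : B),
    Q.cocone.ι.app b ≫ f ≫ P.cone.π.app a = Q.π.app (a, b) ≫ P.ι.app (a, b)

end Iterated

section Levelwise

variable {C : Type u} [Category.{v} C] {A : Type v} [SmallCategory A]
  {B : Type u₂} [Category.{w₂} B] {X : A × B ⥤ Pro C}

/-- The functor `(b, (a, s)) ↦ ((a, b), s)`. -/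
def regroup (A : Type u₁) [Category.{w₁} A] (B : Type u₂) [Category.{w₂} B] (I : Type u₃)
    [Category.{w} I] : B × (A × I) ⥤ (A × B) × I where
  obj p := ((p.2.1, p.1), p.2.2)
  map f := ((f.2.1, f.1), f.2.2)
  map_id _ := rfl
  map_comp _ _ := rfl

/-- A level representation of `X : A × B ⥤ Pro C`, seen as a `B`-diagram of `A × I`-diagrams
`(a, s) ↦ diag ((a, b), s)` in `C`. -/
def LevelRep.columns (R : LevelRep X) : B ⥤ A × R.I ⥤ C :=
  Functor.curry.obj (regroup A B R.I ⋙ R.diag)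

/-- A cocone `K` on a diagram of functors `J ⥤ C` is a levelwise colimit if for every `j` its
value at `j` is a colimit cocone in `C`. -/
def IsLevelwiseColimit {J : Type u₁} [Category.{w₁} J] {Y : B ⥤ J ⥤ C} (K : Cocone Y) : Prop :=
  ∀ j : J, Nonempty (IsColimit (((evaluation J C).obj j).mapCocone K))

/-- A cocone `K` on the columns gives maps `diag ((a, b), s) ⟶ K (a, s)`, natural in `s` and in
`(a, b)`. -/
def LevelRep.toColumn (R : LevelRep X) (K : Cocone R.columns) :
    Functor.curry.obj R.diag ⟶ CategoryTheory.Prod.fst A B ⋙ Functor.curry.obj K.pt where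
  app p :=
    { app := fun s => (K.ι.app p.2).app (p.1, s)
      naturality := fun s s' f =>
        (K.ι.app p.2).naturality
          (show ((p.1, s) : A × R.I) ⟶ (p.1, s') from (𝟙 p.1, f)) }
  naturality p q f := by
    ext s
    have h₁ := (K.ι.app p.2).naturality
      (show ((p.1, s) : A × R.I) ⟶ (q.1, s) from (f.1, 𝟙 s))
    have h₂ := congrArg (fun η => NatTrans.app η ((q.1, s) : A × R.I)) (K.w f.2)
    refine Eq.trans ?_ h₁
    refine Eq.trans ?_ (congrArg
      (fun k => (R.columns.obj p.2).map
        (show ((p.1, s) : A × R.I) ⟶ (q.1, s) from (f.1, 𝟙 s)) ≫ k) h₂)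
    refine Eq.trans ?_ (Category.assoc _ _ _)
    refine congrArg (fun k => k ≫ (K.ι.app q.2).app (q.1, s)) ?_
    refine Eq.trans ?_ (R.diag.map_comp
      (show ((p.1, p.2), s) ⟶ ((q.1, p.2), s) from ((f.1, 𝟙 p.2), 𝟙 s))
      (show ((q.1, p.2), s) ⟶ ((q.1, q.2), s) from ((𝟙 q.1, f.2), 𝟙 s)))
    refine congrArg (fun k => R.diag.map k) ?_
    refine Prod.ext (Prod.ext ?_ ?_) ?_
    · exact (Category.comp_id _).symm
    · exact (Category.id_comp _).symm
    · exact (Category.comp_id _).symm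

/-- The projections from the pro-objects `(a, s) ↦ diag ((a, b), s)` indexed by `A × I` to the
pro-objects `s ↦ diag ((a, b), s)` indexed by `I`. -/
def LevelRep.fromColumn [IsCofiltered A] (R : LevelRep X) :
    CategoryTheory.Prod.snd A B ⋙ R.columns ⋙ level (A × R.I) ⟶
      Functor.curry.obj R.diag ⋙ level R.I where
  app p := (levelCone (R.columns.obj p.2)).π.app p.1
  naturality p q f := by
    refine Pro.Hom.ext (funext fun s => ?_)
    let Y := (level (A × R.I)).obj (R.columns.obj p.2)
    let u : ((p.1, s) : A × R.I) ⟶ (q.1, s) := (f.1, 𝟙 s)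
    let g : ((q.1, p.2), s) ⟶ ((q.1, q.2), s) := ((𝟙 q.1, f.2), 𝟙 s)
    let k : ((p.1, p.2), s) ⟶ ((q.1, p.2), s) := ((f.1, 𝟙 p.2), 𝟙 s)
    let m : ((p.1, p.2), s) ⟶ ((q.1, q.2), s) := (f, 𝟙 s)
    change Germ.mk Y (q.1, s) (R.diag.map g ≫ 𝟙 (R.diag.obj ((q.1, q.2), s))) =
      Germ.mk Y (p.1, s) (𝟙 (R.diag.obj ((p.1, p.2), s)) ≫ R.diag.map m)
    have hm : k ≫ g = m := Prod.ext
      (Prod.ext (Category.comp_id f.1) (Category.id_comp f.2)) (Category.comp_id (𝟙 s))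
    have h₁ : R.diag.map g ≫ 𝟙 (R.diag.obj ((q.1, q.2), s)) = R.diag.map g :=
      Category.comp_id _
    have h₂ : 𝟙 (R.diag.obj ((p.1, p.2), s)) ≫ R.diag.map m = R.diag.map k ≫ R.diag.map g :=
      (Category.id_comp _).trans ((congrArg (fun x => R.diag.map x) hm).symm.trans
        (R.diag.map_comp k g))
    exact (congrArg (Germ.mk Y (q.1, s)) h₁).trans ((Germ.mk_map (X := Y) u (R.diag.map g)).symm.trans
      (congrArg (Germ.mk Y (p.1, s)) h₂).symm)

variable [IsCofiltered A]

/-- For a cocone `K` on the columns of a level representation of `X`: the pro-objects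
`s ↦ K (a, s)` indexed by `I`, the levelwise maps from `X (a, b)` to them, and the projections
to them from the pro-object `(a, s) ↦ K (a, s)` indexed by `A × I`. -/
def LevelRep.limColim (R : LevelRep X) (K : Cocone R.columns) : LimColim X where
  col := Functor.curry.obj K.pt ⋙ level R.I
  ι := R.iso.hom ≫ Functor.whiskerRight (R.toColumn K) (level R.I)
  cone := levelCone K.pt

/-- For a cocone `K` on the columns of a level representation of `X`: the pro-objects
`(a, s) ↦ diag ((a, b), s)` indexed by `A × I`, their projections to the `X (a, b)`, and the
levelwise maps from them to the pro-object `(a, s) ↦ K (a, s)` indexed by `A × I`. -/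
def LevelRep.colimLim (R : LevelRep X) (K : Cocone R.columns) : ColimLim X where
  lim := R.columns ⋙ level (A × R.I)
  π := R.fromColumn ≫ R.iso.inv
  cocone := (level (A × R.I)).mapCocone K

end Levelwise

end ProCategory

/-! A pro-object `X` is governed by its germs, the functor `c ↦ Germ X c = colim_t Hom (X_t, c)`:
morphisms into `Y` are compatible families of germs. In these terms a cocone is a colimit exactly
when its germs are the limit of the germs of the diagram (`IsGermColimit`; the harder direction
tests against constant pro-objects). A cofiltered cone is a limit when its germs are the filtered
colimit of the germs of the diagram (`IsGermLimit`). Commutation of cofiltered limits with finite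
colimits thus becomes commutation of filtered colimits with finite limits of sets, carried out by
hand in `isGermColimit_comparisonCocone`. The same exchange shows in
`IsLevelwiseColimit.isColimit_level` that finite colimits can be taken levelwise.

It remains to see that every limit cone is a germ limit. By uniqueness of limits, one germ limit
cone suffices. If the diagram has a level representation `F`, the pro-object `F` indexed by `A × I`
works (`isGermLimit_levelCone`). In general, `A` receives an initial functor from a directed set in
which every element has finitely many upper bounds, and over such a shape level representations
exist (`exists_levelRep_of_isCofiniteDirect`). Their index category consists of all lifts of the
diagram to representatives in `C` ("models"). Well-founded recursion along the shape produces enough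
models: at each object only finitely many germs must be represented and finitely many equations
enforced. The argument also covers the product of such a directed set with a finite loopless
category. -/

namespace ProCategory

/-! ### Finitely many conditions in a cofiltered category -/

section Cofiltered

/-- In a cofiltered category, finitely many conditions on arrows to `t` which are stable under
precomposition and can be satisfied one by one can be satisfied simultaneously. -/
theorem exists_forall_of_cofiltered {J : Type u₁} [Category.{w₁} J] [IsCofilteredOrEmpty J]
    {ι : Type u₂} [Finite ι] (t : J) (P : ι → ∀ r : J, (r ⟶ t) → Prop)
    (hP : ∀ (i : ι) (r : J) (a : r ⟶ t) (r' : J) (b : r' ⟶ r), P i r a → P i r' (b ≫ a))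
    (h : ∀ i, ∃ (r : J) (a : r ⟶ t), P i r a) :
    ∃ (r : J) (a : r ⟶ t), ∀ i, P i r a := by
  choose r a ha using h
  obtain ⟨k, e, b, hb⟩ := IsCofiltered.wideCospan a
  exact ⟨k, e, fun i => by rw [← hb i]; exact hP _ _ _ _ _ (ha i)⟩

end Cofiltered

/-! ### Calculus of germs -/

section Germs

variable {C : Type u} [Category.{v} C]

/-- The two restriction arrows witnessing equality can themselves be equalised, so one arrow
suffices. -/
theorem Germ.mk_eq_mk_iff {X : Pro C} {c : C} {t : X.Idx} {f g : X.diag.obj t ⟶ c} :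
    Germ.mk X t f = Germ.mk X t g ↔
      ∃ (r : X.Idx) (a : r ⟶ t), X.diag.map a ≫ f = X.diag.map a ≫ g := by
  rw [Germ.mk_eq_iff]
  constructor
  · rintro ⟨r, a, b, h⟩
    refine ⟨IsCofiltered.eq a b, IsCofiltered.eqHom a b ≫ a, ?_⟩
    rw [Functor.map_comp, Category.assoc, h, ← Category.assoc, ← Functor.map_comp,
      ← IsCofiltered.eq_condition, Functor.map_comp]
  · rintro ⟨r, a, h⟩
    exact ⟨r, a, a, h⟩

theorem Germ.exists_rep {X : Pro C} {c : C} (x : Germ X c) :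
    ∃ (t : X.Idx) (f : X.diag.obj t ⟶ c), Germ.mk X t f = x := by
  induction x using Germ.ind with
  | h t f => exact ⟨t, f, rfl⟩

/-- Finitely many germs have representatives at a common index, which can be taken above any
given index. -/
theorem Germ.exists_common_rep {X : Pro C} (t₀ : X.Idx) {ι : Type u₁} [Finite ι] {c : ι → C}
    (x : ∀ i, Germ X (c i)) :
    ∃ (t : X.Idx) (_ : t ⟶ t₀) (f : ∀ i, X.diag.obj t ⟶ c i), ∀ i, Germ.mk X t (f i) = x i := by
  obtain ⟨t, a, h⟩ := exists_forall_of_cofiltered t₀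
    (fun i t _ => ∃ f : X.diag.obj t ⟶ c i, Germ.mk X t f = x i)
    (fun i r a r' b ⟨f, hf⟩ => ⟨X.diag.map b ≫ f, by rw [Germ.mk_map, hf]⟩)
    (fun i => by
      obtain ⟨t, f, hf⟩ := (x i).exists_rep
      exact ⟨IsCofiltered.min t₀ t, IsCofiltered.minToLeft _ _,
        X.diag.map (IsCofiltered.minToRight _ _) ≫ f, by rw [Germ.mk_map, hf]⟩)
  choose f hf using h
  exact ⟨t, a, f, hf⟩

theorem Germ.exists_rep_pair {X : Pro C} {c : C} (x y : Germ X c) :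
    ∃ (t : X.Idx) (f g : X.diag.obj t ⟶ c), Germ.mk X t f = x ∧ Germ.mk X t g = y := by
  obtain ⟨t, -, f, hf⟩ := Germ.exists_common_rep (IsCofiltered.nonempty.some : X.Idx)
    (fun i : Bool => cond i x y)
  exact ⟨t, f true, f false, hf true, hf false⟩

/-- Finitely many equations between germs with representatives at `t` hold at some index
above `t`. -/
theorem Germ.exists_map_eq {X : Pro C} {t : X.Idx} {ι : Type u₁} [Finite ι] {c : ι → C}
    (f g : ∀ i, X.diag.obj t ⟶ c i) (h : ∀ i, Germ.mk X t (f i) = Germ.mk X t (g i)) :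
    ∃ (r : X.Idx) (a : r ⟶ t), ∀ i, X.diag.map a ≫ f i = X.diag.map a ≫ g i :=
  exists_forall_of_cofiltered t (fun i _ a => X.diag.map a ≫ f i = X.diag.map a ≫ g i)
    (fun i r a r' b hi => by simp [hi]) (fun i => Germ.mk_eq_mk_iff.1 (h i))

/-- Precomposition of a germ with a morphism of pro-objects. -/
def Germ.res {X Y : Pro C} (φ : X ⟶ Y) {c : C} (y : Germ Y c) : Germ X c := Germ.pull φ y

@[simp]
theorem Germ.res_id {X : Pro C} {c : C} (x : Germ X c) : x.res (𝟙 X) = x := Germ.pull_id x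

@[simp]
theorem Germ.res_comp {X Y Z : Pro C} (φ : X ⟶ Y) (ψ : Y ⟶ Z) {c : C} (z : Germ Z c) :
    z.res (φ ≫ ψ) = (z.res ψ).res φ := Germ.pull_comp φ ψ z

theorem Germ.res_push {X Y : Pro C} (φ : X ⟶ Y) {c d : C} (y : Germ Y c) (g : c ⟶ d) :
    (y.push g).res φ = (y.res φ).push g := Germ.pull_push φ y g

/-- The germ at `s` of the identity of `X_s`. -/
def Germ.proj (X : Pro C) (s : X.Idx) : Germ X (X.diag.obj s) := Germ.mk X s (𝟙 _)

@[simp]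
theorem Germ.proj_push (X : Pro C) (s : X.Idx) {c : C} (f : X.diag.obj s ⟶ c) :
    (Germ.proj X s).push f = Germ.mk X s f := by simp [Germ.proj]

/-- Every germ is pushed forward from a projection, so the values of `res φ` on projections
determine it. -/
theorem Germ.res_mk {X Y : Pro C} (φ : X ⟶ Y) (s : Y.Idx) {c : C} (f : Y.diag.obj s ⟶ c) :
    (Germ.mk Y s f).res φ = ((Germ.proj Y s).res φ).push f := by
  rw [← Germ.proj_push, Germ.res_push]

theorem Pro.Hom.toFun_eq {X Y : Pro C} (φ : X ⟶ Y) (s : Y.Idx) :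
    Pro.Hom.toFun φ s = (Germ.proj Y s).res φ :=
  (Germ.push_id _).symm

theorem Pro.hom_ext {X Y : Pro C} {φ ψ : X ⟶ Y}
    (h : ∀ s, (Germ.proj Y s).res φ = (Germ.proj Y s).res ψ) : φ = ψ :=
  Pro.Hom.ext (funext fun s => by
    rw [Pro.Hom.toFun_eq, Pro.Hom.toFun_eq, h])

/-- A morphism of pro-objects is a compatible family of germs. -/
def Pro.homMk {X Y : Pro C} (x : ∀ s, Germ X (Y.diag.obj s))
    (hx : ∀ {s s' : Y.Idx} (f : s ⟶ s'), (x s).push (Y.diag.map f) = x s') : X ⟶ Y :=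
  (⟨x, hx⟩ : Pro.Hom X Y)

@[simp]
theorem Pro.proj_res_homMk {X Y : Pro C} (x : ∀ s, Germ X (Y.diag.obj s))
    (hx : ∀ {s s' : Y.Idx} (f : s ⟶ s'), (x s).push (Y.diag.map f) = x s') (s : Y.Idx) :
    (Germ.proj Y s).res (Pro.homMk x hx) = x s :=
  Germ.push_id _

theorem Germ.proj_push_map (X : Pro C) {s s' : X.Idx} (f : s ⟶ s') :
    (Germ.proj X s).push (X.diag.map f) = Germ.proj X s' := by
  have := Germ.mk_map (X := X) f (𝟙 _)
  simpa [Germ.proj] using this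

/-- A Yoneda argument: preimages of the projections of `X` assemble into a one-sided inverse, and
injectivity makes it two-sided. -/
theorem Pro.isIso_of_bijective {X Y : Pro C} (φ : X ⟶ Y)
    (h : ∀ c : C, Function.Bijective fun y : Germ Y c => y.res φ) : IsIso φ := by
  choose x hx using fun s => (h _).2 (Germ.proj X s)
  have hψ : ∀ {s s' : X.Idx} (f : s ⟶ s'), (x s).push (X.diag.map f) = x s' := fun {s s'} f =>
    (h _).1 (by
      change ((x s).push _).res φ = (x s').res φ
      rw [Germ.res_push]
      exact (congrArg (fun y => Germ.push y (X.diag.map f)) (hx s)).trans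
        ((Germ.proj_push_map X f).trans (hx s').symm))
  have e : φ ≫ Pro.homMk x hψ = 𝟙 X := Pro.hom_ext fun s => by
    rw [Germ.res_comp, Pro.proj_res_homMk, Germ.res_id]
    exact hx s
  refine ⟨Pro.homMk x hψ, e, Pro.hom_ext fun s => (h _).1 ?_⟩
  change ((Germ.proj Y s).res (Pro.homMk x hψ ≫ φ)).res φ = ((Germ.proj Y s).res (𝟙 Y)).res φ
  rw [← Germ.res_comp, ← Germ.res_comp, ← Category.assoc, e, Category.id_comp, Category.comp_id]

theorem level_map_res {I : Type v} [SmallCategory I] [IsCofiltered I] {F G : I ⥤ C} (η : F ⟶ G)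
    (s : I) {c : C} (f : G.obj s ⟶ c) :
    (Germ.mk ((level I).obj G) s f).res ((level I).map η) =
      Germ.mk ((level I).obj F) s (η.app s ≫ f) := rfl

theorem levelCone_π_res {A I : Type v} [SmallCategory A] [IsCofiltered A] [SmallCategory I]
    [IsCofiltered I] (F : A × I ⥤ C) (a : A) (s : I) {c : C} (f : F.obj (a, s) ⟶ c) :
    (Germ.mk ((Functor.curry.obj F ⋙ level I).obj a) s f).res ((levelCone F).π.app a) =
      Germ.mk ((level (A × I)).obj F) (a, s) f :=
  congrArg (Germ.mk ((level (A × I)).obj F) ((a, s) : A × I)) (Category.id_comp f)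

end Germs

/-! ### Legs of cones and cocones -/

section Legs

variable {D : Type u₃} [Category.{w} D] {B : Type u₂} [Category.{w₂} B] {F : B ⥤ D}

/-- The morphism from `F b` to the vertex of a cocone on `F`. -/
def coleg (t : Cocone F) (b : B) : F.obj b ⟶ t.pt := t.ι.app b

theorem map_coleg (t : Cocone F) {b b' : B} (f : b ⟶ b') :
    F.map f ≫ coleg t b' = coleg t b := t.w f

theorem coleg_desc {t : Cocone F} (ht : IsColimit t) (s : Cocone F) (b : B) :
    coleg t b ≫ ht.desc s = coleg s b := ht.fac s b

/-- The morphism from the vertex of a cone over `F` to `F a`. -/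
def leg (t : Cone F) (a : B) : t.pt ⟶ F.obj a := t.π.app a

theorem leg_map (t : Cone F) {a a' : B} (f : a ⟶ a') : leg t a ≫ F.map f = leg t a' := t.w f

end Legs

/-! ### Colimits of pro-objects in terms of germs -/

section Colimits

variable {C : Type u} [Category.{v} C]

/-- A constant pro-object. -/
def constPro (c : C) : Pro C := (level (Discrete PUnit.{v + 1})).obj ((Functor.const _).obj c)

/-- The morphism to a constant pro-object given by a germ. -/
def toConstPro {X : Pro C} {c : C} (x : Germ X c) : X ⟶ constPro c :=
  Pro.homMk (Y := constPro c) (fun _ => x) (fun _ => Germ.push_id x)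

theorem toConstPro_res {X : Pro C} {c : C} (x : Germ X c) :
    Germ.res (toConstPro x) (Germ.proj (constPro c) ⟨PUnit.unit⟩) = x :=
  Germ.push_id x

theorem comp_toConstPro {X Y : Pro C} {c : C} (φ : X ⟶ Y) (y : Germ Y c) :
    φ ≫ toConstPro y = toConstPro (y.res φ) :=
  Pro.hom_ext (Y := constPro c) fun ⟨_⟩ => by
    rw [Germ.res_comp]
    exact (congrArg (Germ.res φ) (toConstPro_res y)).trans (toConstPro_res _).symm

variable {B : Type u₂} [Category.{w₂} B] {F : B ⥤ Pro C}

/-- For all `c`, the classes of maps from the vertex of `t` to `c` are the compatible families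
of classes of maps from the `F b` to `c`. -/
def IsGermColimit (t : Cocone F) : Prop :=
  ∀ (c : C) (x : ∀ b, Germ (F.obj b) c),
    (∀ (b b' : B) (f : b ⟶ b'), (x b').res (F.map f) = x b) →
      ∃! g : Germ t.pt c, ∀ b, g.res (coleg t b) = x b

theorem IsGermColimit.eq {t : Cocone F} (ht : IsGermColimit t) {c : C} {g g' : Germ t.pt c}
    (h : ∀ b, g.res (coleg t b) = g'.res (coleg t b)) : g = g' :=
  (ht c (fun b => g'.res (coleg t b)) (fun b b' f => by
    rw [← Germ.res_comp, map_coleg])).unique h (fun _ => rfl)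

/-- A map out of `t.pt` is a compatible family of germs on it, and the hypothesis glues each germ
from its restrictions to the `F b`. Uniqueness of glueing yields compatibility. -/
theorem IsGermColimit.isColimit {t : Cocone F} (ht : IsGermColimit t) :
    Nonempty (IsColimit t) := by
  have key : ∀ (s : Cocone F) (σ : s.pt.Idx), ∃ g : Germ t.pt (s.pt.diag.obj σ),
      ∀ b, g.res (coleg t b) = (Germ.proj s.pt σ).res (coleg s b) := fun s σ =>
    (ht _ (fun b => (Germ.proj s.pt σ).res (coleg s b)) (fun b b' f => by
      rw [← Germ.res_comp, map_coleg])).exists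
  choose y hy using key
  have compat : ∀ (s : Cocone F) {σ σ' : s.pt.Idx} (f : σ ⟶ σ'),
      (y s σ).push (s.pt.diag.map f) = y s σ' := by
    intro s σ σ' f
    refine ht.eq fun b => ?_
    rw [Germ.res_push, hy, hy, ← Germ.res_push, Germ.proj_push_map]
  refine ⟨{ desc := fun s => Pro.homMk (y s) (compat s), fac := ?_, uniq := ?_ }⟩
  · intro s b
    refine Pro.hom_ext fun σ => ?_
    change (Germ.proj s.pt σ).res (coleg t b ≫ _) = (Germ.proj s.pt σ).res (coleg s b)
    rw [Germ.res_comp, Pro.proj_res_homMk, hy]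
  · intro s m hm
    refine Pro.hom_ext fun σ => ht.eq fun b => ?_
    rw [Pro.proj_res_homMk, hy, ← Germ.res_comp]
    exact congrArg (fun φ => Germ.res φ (Germ.proj s.pt σ)) (hm b)

/-- Germs with values in `c` are the morphisms to the constant pro-object `c`, so the universal
property applied to constant vertices is the claim. -/
theorem isGermColimit_of_isColimit {t : Cocone F} (ht : IsColimit t) : IsGermColimit t := by
  intro c x hx
  let s : Cocone F :=
    { pt := constPro c
      ι :=
        { app := fun b => toConstPro (x b)
          naturality := fun b b' f => by
            rw [comp_toConstPro, hx]
            exact (Category.comp_id _).symm } }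
  refine ⟨Germ.res (ht.desc s) (Germ.proj (constPro c) ⟨PUnit.unit⟩), fun b => ?_, fun g hg => ?_⟩
  · have h := congrArg (fun φ => Germ.res φ (Germ.proj (constPro c) ⟨PUnit.unit⟩))
      (coleg_desc ht s b)
    simp only [Germ.res_comp] at h
    exact h.trans (toConstPro_res _)
  · have h : toConstPro g = ht.desc s := ht.hom_ext fun b => by
      change coleg t b ≫ _ = coleg t b ≫ _
      rw [coleg_desc, comp_toConstPro, hg]
      rfl
    rw [← h]
    exact (toConstPro_res g).symm

end Colimits

/-! ### Cofiltered limits of pro-objects in terms of germs -/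

section Limits

variable {C : Type u} [Category.{v} C] {A : Type u₁} [Category.{w₁} A] {F : A ⥤ Pro C}

/-- For all `c`, the classes of maps from the vertex of `t` to `c` are the colimit over `a` of
the classes of maps from `F a` to `c`. -/
structure IsGermLimit (t : Cone F) : Prop where
  exists_res : ∀ {c : C} (g : Germ t.pt c), ∃ (a : A) (x : Germ (F.obj a) c),
    x.res (leg t a) = g
  exists_map_res : ∀ {c : C} (a : A) (x y : Germ (F.obj a) c),
    x.res (leg t a) = y.res (leg t a) →
      ∃ (a' : A) (f : a' ⟶ a), x.res (F.map f) = y.res (F.map f)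

/-- This makes the map from germs of `t.pt` to germs of `s.pt` well defined: a germ is transported
by any representative on some `F a`. -/
theorem IsGermLimit.res_eq [IsCofilteredOrEmpty A] {t : Cone F} (ht : IsGermLimit t) (s : Cone F)
    {c : C} {a a' : A} {x : Germ (F.obj a) c} {x' : Germ (F.obj a') c}
    (h : x.res (leg t a) = x'.res (leg t a')) : x.res (leg s a) = x'.res (leg s a') := by
  rw [← leg_map t (IsCofiltered.minToLeft a a'), ← leg_map t (IsCofiltered.minToRight a a'),
    Germ.res_comp, Germ.res_comp] at h
  obtain ⟨r, f, hf⟩ := ht.exists_map_res _ _ _ h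
  rw [← leg_map s (f ≫ IsCofiltered.minToLeft a a'), ← leg_map s (f ≫ IsCofiltered.minToRight a a'),
    F.map_comp, F.map_comp, Germ.res_comp, Germ.res_comp, Germ.res_comp, Germ.res_comp, hf]

theorem IsGermLimit.isLimit [IsCofilteredOrEmpty A] {t : Cone F} (ht : IsGermLimit t) :
    Nonempty (IsLimit t) := by
  choose a x hx using fun σ : t.pt.Idx => ht.exists_res (Germ.proj t.pt σ)
  have compat : ∀ (s : Cone F) {σ σ' : t.pt.Idx} (f : σ ⟶ σ'),
      ((x σ).res (leg s (a σ))).push (t.pt.diag.map f) = (x σ').res (leg s (a σ')) := by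
    intro s σ σ' f
    rw [← Germ.res_push]
    refine ht.res_eq s ?_
    rw [Germ.res_push, hx, hx, Germ.proj_push_map]
  refine ⟨{ lift := fun s => Pro.homMk (fun σ => (x σ).res (leg s (a σ))) (compat s),
            fac := ?_, uniq := ?_ }⟩
  · intro s j
    refine Pro.hom_ext fun σ => ?_
    change (Germ.proj (F.obj j) σ).res (_ ≫ leg t j) = (Germ.proj (F.obj j) σ).res (leg s j)
    rw [Germ.res_comp]
    -- The leg of `t` at `j` yields a germ on `t.pt`, hence one pushed from `x τ`. This gives two
    -- representatives of the same germ, to which `res_eq` applies.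
    obtain ⟨τ, f, hf⟩ := ((Germ.proj (F.obj j) σ).res (leg t j)).exists_rep
    rw [← hf, Germ.res_mk, Pro.proj_res_homMk, ← Germ.res_push]
    refine ht.res_eq s ?_
    rw [Germ.res_push, hx, Germ.proj_push, hf]
  · intro s m hm
    refine Pro.hom_ext fun σ => ?_
    rw [Pro.proj_res_homMk, ← hx, ← Germ.res_comp]
    exact congrArg (fun φ => Germ.res φ (x σ)) (hm (a σ))

theorem IsGermLimit.of_isLimit {t t' : Cone F} (ht : IsGermLimit t) (h : IsLimit t)
    (h' : IsLimit t') : IsGermLimit t' := by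
  let e := h.conePointUniqueUpToIso h'
  have he : ∀ a, leg t' a = e.inv ≫ leg t a := fun a =>
    (h.conePointUniqueUpToIso_inv_comp h' a).symm
  constructor
  · intro c g
    obtain ⟨a, x, hx⟩ := ht.exists_res (g.res e.hom)
    refine ⟨a, x, ?_⟩
    rw [he, Germ.res_comp, hx, ← Germ.res_comp, e.inv_hom_id, Germ.res_id]
  · intro c a x y hxy
    refine ht.exists_map_res a x y ?_
    have := congrArg (Germ.res e.hom) hxy
    rwa [← Germ.res_comp, ← Germ.res_comp, he, e.hom_inv_id_assoc] at this

/-- A colimit over `A × I` is an iterated colimit, first over `I` and then over `A`. -/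
theorem isGermLimit_levelCone {A I : Type v} [SmallCategory A] [IsCofiltered A] [SmallCategory I]
    [IsCofiltered I] (F : A × I ⥤ C) : IsGermLimit (levelCone F) := by
  constructor
  · intro c g
    obtain ⟨⟨a, s⟩, f, rfl⟩ := g.exists_rep
    exact ⟨a, Germ.mk ((Functor.curry.obj F ⋙ level I).obj a) s f, levelCone_π_res F a s f⟩
  · intro c a x y h
    obtain ⟨s, p, q, rfl, rfl⟩ : ∃ (s : I) (p q : F.obj (a, s) ⟶ c),
        Germ.mk ((Functor.curry.obj F ⋙ level I).obj a) s p = x ∧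
          Germ.mk ((Functor.curry.obj F ⋙ level I).obj a) s q = y := Germ.exists_rep_pair x y
    obtain ⟨⟨a', s'⟩, ⟨k, l⟩, hr⟩ := Germ.mk_eq_mk_iff.1
      ((levelCone_π_res F a s p).symm.trans (h.trans (levelCone_π_res F a s q)))
    have key : ∀ p : F.obj (a, s) ⟶ c,
        Germ.res ((Functor.curry.obj F ⋙ level I).map k)
            (Germ.mk ((Functor.curry.obj F ⋙ level I).obj a) s p) =
          Germ.mk ((Functor.curry.obj F ⋙ level I).obj a') s'
            (F.map (show (a', s') ⟶ (a, s) from (k, l)) ≫ p) := by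
      intro p
      refine (level_map_res ((Functor.curry.obj F).map k) s p).trans
        ((Germ.mk_map (X := (level I).obj ((Functor.curry.obj F).obj a')) l _).symm.trans
          (congrArg (Germ.mk ((level I).obj ((Functor.curry.obj F).obj a')) s') ?_))
      refine (Category.assoc _ _ _).symm.trans (congrArg (fun z => z ≫ p) ?_)
      refine (F.map_comp _ _).symm.trans (congrArg (fun z => F.map z) ?_)
      exact Prod.ext (Category.id_comp k) (Category.comp_id l)
    refine ⟨a', k, (key p).trans (Eq.trans ?_ (key q).symm)⟩
    exact congrArg (Germ.mk ((level I).obj ((Functor.curry.obj F).obj a')) s') hr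

end Limits

/-! ### Levelwise finite colimits -/

section Levelwise

variable {C : Type u} [Category.{v} C] {B : Type w} [SmallCategory B] [FinCategory B]
  {J : Type v} [SmallCategory J] [IsCofiltered J]

/-- On germs this is `lim_b colim_j Hom (Y b j, c) = colim_j lim_b Hom (Y b j, c)`, whose right side
is `colim_j Hom (K j, c)`; it holds since `B` is finite and `J` cofiltered. -/
theorem IsLevelwiseColimit.isColimit_level {Y : B ⥤ J ⥤ C} {K : Cocone Y}
    (hK : IsLevelwiseColimit K) : Nonempty (IsColimit ((level J).mapCocone K)) := by
  refine IsGermColimit.isColimit fun c x hx => existsUnique_of_exists_of_unique ?_ ?_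
  · obtain ⟨t, -, ht⟩ := exists_forall_of_cofiltered (IsCofiltered.nonempty.some : J)
      (fun b t _ => ∃ f : (Y.obj b).obj t ⟶ c, Germ.mk ((level J).obj (Y.obj b)) t f = x b)
      (fun b r a r' k ⟨f, hf⟩ => ⟨(Y.obj b).map k ≫ f,
        (Germ.mk_map (X := (level J).obj (Y.obj b)) k f).trans hf⟩)
      (fun b => by
        obtain ⟨t, f, hf⟩ := (x b).exists_rep
        exact ⟨IsCofiltered.min _ t, IsCofiltered.minToLeft _ _,
          (Y.obj b).map (IsCofiltered.minToRight _ _) ≫ f,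
          (Germ.mk_map (X := (level J).obj (Y.obj b)) _ f).trans hf⟩)
    choose f hf using ht
    -- Compatibility of the representatives is one equation for each of the finitely many arrows of
    -- `B`, so all of them hold at some `r`.
    obtain ⟨r, a, h⟩ := exists_forall_of_cofiltered t
      (fun (g : Σ b b' : B, b ⟶ b') r a => (Y.obj g.1).map a ≫ (Y.map g.2.2).app t ≫ f g.2.1 =
        (Y.obj g.1).map a ≫ f g.1)
      (fun g r a r' k h => by simp [h])
      (fun ⟨b, b', g⟩ => by
        refine Germ.mk_eq_mk_iff (X := (level J).obj (Y.obj b)).1 ?_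
        refine Eq.trans ?_ ((hx b b' g).trans (hf b).symm)
        rw [← hf b']
        rfl)
    let s : Cocone (Y ⋙ (evaluation J C).obj r) :=
      { pt := c
        ι :=
          { app := fun b => (Y.obj b).map a ≫ f b
            naturality := fun b b' g => by
              have := h ⟨b, b', g⟩
              simp only [← Category.assoc, NatTrans.naturality] at this
              simpa using this } }
    refine ⟨Germ.mk ((level J).obj K.pt) r ((hK r).some.desc s), fun b => ?_⟩
    refine Eq.trans (congrArg (Germ.mk ((level J).obj (Y.obj b)) r) ((hK r).some.fac s b)) ?_
    exact (Germ.mk_map (X := (level J).obj (Y.obj b)) a (f b)).trans (hf b)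
  · intro g g' hg hg'
    obtain ⟨s, p, q, rfl, rfl⟩ : ∃ (s : J) (p q : K.pt.obj s ⟶ c),
        Germ.mk ((level J).obj K.pt) s p = g ∧ Germ.mk ((level J).obj K.pt) s q = g' :=
      Germ.exists_rep_pair g g'
    obtain ⟨r, a, h⟩ := exists_forall_of_cofiltered (J := J) s
      (fun (b : B) r a => (Y.obj b).map a ≫ (K.ι.app b).app s ≫ p =
        (Y.obj b).map a ≫ (K.ι.app b).app s ≫ q)
      (fun g r a r' k h => by simp only [Functor.map_comp, Category.assoc, h])
      (fun b => Germ.mk_eq_mk_iff (X := (level J).obj (Y.obj b)).1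
        ((hg b).trans (hg' b).symm))
    refine Germ.mk_eq_mk_iff.2 ⟨r, a, (hK r).some.hom_ext fun b => ?_⟩
    have := h b
    simp only [← Category.assoc, NatTrans.naturality] at this
    exact (Category.assoc _ _ _).symm.trans (this.trans (Category.assoc _ _ _))

end Levelwise

/-! ### The comparison cocone of a two-variable diagram -/

section Squares

variable {A : Type u₁} [Category.{w₁} A] {B : Type u₂} [Category.{w₂} B]
  {D : Type u₃} [Category.{w} D] {X : A × B ⥤ D}

/-- The action of `X` on an arrow of `A`. -/
def mapLeft (X : A × B ⥤ D) {a a' : A} (f : a ⟶ a') (b : B) : X.obj (a, b) ⟶ X.obj (a', b) :=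
  X.map (show ((a, b) : A × B) ⟶ (a', b) from (f, 𝟙 b))

theorem mapLeft_comp (X : A × B ⥤ D) {a a' a'' : A} (f : a ⟶ a') (f' : a' ⟶ a'') (b : B) :
    mapLeft X (f ≫ f') b = mapLeft X f b ≫ mapLeft X f' b := by
  refine Eq.trans (congrArg (fun z => X.map z) ?_) (X.map_comp _ _)
  exact Prod.ext rfl (Category.id_comp (𝟙 b)).symm

/-- The action of `X` on an arrow of `B`. -/
def mapRight (X : A × B ⥤ D) (a : A) {b b' : B} (g : b ⟶ b') : X.obj (a, b) ⟶ X.obj (a, b') :=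
  X.map (show ((a, b) : A × B) ⟶ (a, b') from (𝟙 a, g))

theorem mapLeft_mapRight (X : A × B ⥤ D) {a a' : A} (f : a ⟶ a') {b b' : B} (g : b ⟶ b') :
    mapLeft X f b ≫ mapRight X a' g = mapRight X a g ≫ mapLeft X f b' := by
  refine (X.map_comp _ _).symm.trans (Eq.trans (congrArg (fun z => X.map z) ?_) (X.map_comp _ _))
  exact Prod.ext ((Category.comp_id f).trans (Category.id_comp f).symm)
    ((Category.id_comp g).trans (Category.comp_id g).symm)

/-- The map `X (a, b) ⟶ colim_b X (a, b)`. -/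
def LimColim.inj (P : LimColim X) (a : A) (b : B) : X.obj (a, b) ⟶ P.col.obj a := P.ι.app (a, b)

theorem LimColim.mapLeft_inj (P : LimColim X) {a a' : A} (f : a ⟶ a') (b : B) :
    mapLeft X f b ≫ P.inj a' b = P.inj a b ≫ P.col.map f :=
  P.ι.naturality (show ((a, b) : A × B) ⟶ (a', b) from (f, 𝟙 b))

theorem LimColim.mapRight_inj (P : LimColim X) (a : A) {b b' : B} (g : b ⟶ b') :
    mapRight X a g ≫ P.inj a b' = P.inj a b :=
  (P.cocone a).w g

variable {L : B ⥤ D}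

/-- The cone with vertex `L b` over the diagram `a ↦ X (a, b)`. -/
def coneAt (π : CategoryTheory.Prod.snd A B ⋙ L ⟶ X) (b : B) :
    Cone ((Functor.curry.obj (CategoryTheory.Prod.swap B A ⋙ X)).obj b) where
  pt := L.obj b
  π :=
    { app := fun a => π.app (a, b)
      naturality := fun a a' f =>
        (congrArg (fun k => k ≫ π.app (a', b)) (L.map_id b).symm).trans
          (π.naturality (show ((a, b) : A × B) ⟶ (a', b) from (f, 𝟙 b))) }

/-- The component `L b ⟶ X (a, b)` of `π`. -/
def projAt (π : CategoryTheory.Prod.snd A B ⋙ L ⟶ X) (a : A) (b : B) :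
    L.obj b ⟶ X.obj (a, b) := π.app (a, b)

theorem projAt_mapLeft (π : CategoryTheory.Prod.snd A B ⋙ L ⟶ X) {a a' : A} (f : a ⟶ a') (b : B) :
    projAt π a b ≫ mapLeft X f b = projAt π a' b :=
  (coneAt π b).w f

theorem map_projAt (π : CategoryTheory.Prod.snd A B ⋙ L ⟶ X) (a : A) {b b' : B} (g : b ⟶ b') :
    L.map g ≫ projAt π a b' = projAt π a b ≫ mapRight X a g :=
  π.naturality (show ((a, b) : A × B) ⟶ (a, b') from (𝟙 a, g))

/-- The cone on `a ↦ colim_b X (a, b)` with vertex `lim_a X (a, b)` for a fixed `b`. -/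
def coneOver (π : CategoryTheory.Prod.snd A B ⋙ L ⟶ X) (P : LimColim X) (b : B) : Cone P.col where
  pt := L.obj b
  π :=
    { app := fun a => projAt π a b ≫ P.inj a b
      naturality := fun a a' f => by
        refine (Category.id_comp _).trans ?_
        rw [Category.assoc, ← P.mapLeft_inj, ← Category.assoc, projAt_mapLeft π] }

/-- The map `lim_a X (a, b) ⟶ lim_a colim_b X (a, b)`. -/
def toLimColim (π : CategoryTheory.Prod.snd A B ⋙ L ⟶ X)
    {P : LimColim X} (hP : IsLimit P.cone) (b : B) :
    L.obj b ⟶ P.cone.pt :=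
  hP.lift (coneOver π P b)

theorem toLimColim_leg (π : CategoryTheory.Prod.snd A B ⋙ L ⟶ X)
    {P : LimColim X} (hP : IsLimit P.cone) (b : B)
    (a : A) : toLimColim π hP b ≫ leg P.cone a = projAt π a b ≫ P.inj a b :=
  hP.fac (coneOver π P b) a

/-- The cocone on `b ↦ lim_a X (a, b)` with vertex `lim_a colim_b X (a, b)`. -/
def comparisonCocone (π : CategoryTheory.Prod.snd A B ⋙ L ⟶ X)
    {P : LimColim X} (hP : IsLimit P.cone) :
    Cocone L where
  pt := P.cone.pt
  ι :=
    { app := fun b => toLimColim π hP b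
      naturality := fun b b' g => by
        refine Eq.trans (hP.hom_ext fun a => ?_) (Category.comp_id (toLimColim π hP b)).symm
        change (L.map g ≫ toLimColim π hP b') ≫ leg P.cone a =
          toLimColim π hP b ≫ leg P.cone a
        rw [Category.assoc, toLimColim_leg π, toLimColim_leg π, ← Category.assoc, map_projAt π,
          Category.assoc, P.mapRight_inj] }

theorem ColimLim.exists_iso_of_isColimit {P : LimColim X} (hP : IsLimit P.cone) (Q : ColimLim X)
    (h : IsColimit (comparisonCocone Q.π hP)) (hQ : IsColimit Q.cocone) :
    ∃ f : Q.cocone.pt ≅ P.cone.pt, IsComparison Q P f.hom := by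
  refine ⟨hQ.coconePointUniqueUpToIso h, fun a b => ?_⟩
  refine Eq.trans ?_ (toLimColim_leg Q.π hP b a)
  refine (Category.assoc _ _ _).symm.trans (congrArg (fun z => z ≫ leg P.cone a) ?_)
  exact hQ.comp_coconePointUniqueUpToIso_hom h b

end Squares

/-! ### The exchange of limit and colimit on germs -/

section Comparison

variable {C : Type u} [Category.{v} C] {A : Type u₁} [Category.{w₁} A] [IsCofiltered A]
  {B : Type w} [SmallCategory B] [FinCategory B] {X : A × B ⥤ Pro C} {L : B ⥤ Pro C}

/-- The core exchange: with `G (a, b)` the germs of `X (a, b)`, the filtered `colim_a` commutes with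
the finite `lim_b` of `G`. For existence, a compatible family is realised at one `a` and made
compatible at one `a' ⟶ a`; uniqueness is similar. -/
theorem isGermColimit_comparisonCocone {P : LimColim X} (hP : IsLimit P.cone)
    (hP' : IsGermLimit P.cone) (hcol : ∀ a, IsGermColimit (P.cocone a))
    (π : CategoryTheory.Prod.snd A B ⋙ L ⟶ X)
    (hQ : ∀ b, IsGermLimit (coneAt π b)) : IsGermColimit (comparisonCocone π hP) := by
  intro c x hx
  refine existsUnique_of_exists_of_unique ?_ ?_
  · obtain ⟨a, -, ha⟩ := exists_forall_of_cofiltered (IsCofiltered.nonempty.some : A)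
      (fun b a _ => ∃ y : Germ (X.obj (a, b)) c, y.res (projAt π a b) = x b)
      (fun b a _ a' f ⟨y, hy⟩ => ⟨y.res (mapLeft X f b), by
        rw [← Germ.res_comp, projAt_mapLeft π, hy]⟩)
      (fun b => by
        obtain ⟨a, y, hy⟩ := (hQ b).exists_res (x b)
        refine ⟨IsCofiltered.min _ a, IsCofiltered.minToLeft _ _,
          Germ.res (mapLeft X (IsCofiltered.minToRight _ _) b) y, ?_⟩
        rw [← Germ.res_comp, projAt_mapLeft π]
        exact hy)
    choose y hy using ha
    obtain ⟨a', f, hf⟩ := exists_forall_of_cofiltered a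
      (fun (g : Σ b b' : B, b ⟶ b') a' f =>
        ((y g.2.1).res (mapRight X a g.2.2)).res (mapLeft X f g.1) =
          (y g.1).res (mapLeft X f g.1))
      (fun g r f r' k h => by
        rw [mapLeft_comp, Germ.res_comp, h, Germ.res_comp])
      (fun ⟨b, b', g⟩ => by
        refine (hQ b).exists_map_res a _ _ ?_
        change Germ.res (projAt π a b) _ = Germ.res (projAt π a b) _
        rw [hy, ← Germ.res_comp, ← map_projAt π, Germ.res_comp, hy, hx])
    -- The family is now strictly compatible at `a'`, so it glues to a germ on `colim_b X (a', b)`.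
    obtain ⟨z, hz, -⟩ := hcol a' c (fun b => (y b).res (mapLeft X f b)) (fun b b' g => by
      change Germ.res (mapRight X a' g) _ = _
      rw [← Germ.res_comp, ← mapLeft_mapRight, Germ.res_comp]
      exact hf ⟨b, b', g⟩)
    refine ⟨z.res (leg P.cone a'), fun b => ?_⟩
    change Germ.res (toLimColim π hP b)
      (Germ.res (leg P.cone a') (show Germ (P.col.obj a') c from z)) = x b
    rw [← Germ.res_comp, toLimColim_leg π, Germ.res_comp]
    refine (congrArg (Germ.res (projAt π a' b)) (hz b)).trans ?_
    rw [← Germ.res_comp, projAt_mapLeft π, hy]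
  · intro g g' hg hg'
    -- Both germs are moved to a common `a`, where they can be compared on each `X (a, b)`.
    obtain ⟨a, z, z', rfl, rfl⟩ : ∃ (a : A) (z z' : Germ (P.col.obj a) c),
        z.res (leg P.cone a) = g ∧ z'.res (leg P.cone a) = g' := by
      obtain ⟨a, z, rfl⟩ := hP'.exists_res g
      obtain ⟨a', z', rfl⟩ := hP'.exists_res g'
      refine ⟨IsCofiltered.min a a', z.res (P.col.map (IsCofiltered.minToLeft _ _)),
        z'.res (P.col.map (IsCofiltered.minToRight _ _)), ?_, ?_⟩ <;>
      rw [← Germ.res_comp, leg_map]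
    obtain ⟨a', f, hf⟩ := exists_forall_of_cofiltered a
      (fun (b : B) a' f => (z.res (P.inj a b)).res (mapLeft X f b) =
        (z'.res (P.inj a b)).res (mapLeft X f b))
      (fun b r f r' k h => by
        rw [mapLeft_comp, Germ.res_comp, h, Germ.res_comp])
      (fun b => by
        refine (hQ b).exists_map_res a _ _ ?_
        change Germ.res (projAt π a b) _ = Germ.res (projAt π a b) _
        rw [← Germ.res_comp, ← Germ.res_comp, ← toLimColim_leg π hP,
          Germ.res_comp, Germ.res_comp]
        exact (hg b).trans (hg' b).symm)
    have h : z.res (P.col.map f) = z'.res (P.col.map f) := (hcol a').eq fun b => by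
      change Germ.res (P.inj a' b) _ = Germ.res (P.inj a' b) _
      rw [← Germ.res_comp, ← Germ.res_comp, ← P.mapLeft_inj, Germ.res_comp, Germ.res_comp, hf]
    rw [← leg_map P.cone f, Germ.res_comp, h, ← Germ.res_comp]

end Comparison

/-! ### Limits and colimits computed by a level representation -/

section LevelReps

variable {C : Type u} [Category.{v} C] {A : Type v} [SmallCategory A] [IsCofiltered A]
  {B : Type w} [SmallCategory B] {X : A × B ⥤ Pro C}

theorem LevelRep.isLimit_colimLim_cone (R : LevelRep X) (K : Cocone R.columns) (b : B) :
    Nonempty (IsLimit ((R.colimLim K).cone b)) := by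
  obtain ⟨h⟩ := (isGermLimit_levelCone (R.columns.obj b)).isLimit
  let e : Functor.curry.obj (R.columns.obj b) ⋙ level R.I ≅
      (Functor.curry.obj (CategoryTheory.Prod.swap B A ⋙ X)).obj b :=
    NatIso.ofComponents (fun a => (R.iso.app (a, b)).symm) (fun {a a'} f =>
      R.iso.inv.naturality (show ((a, b) : A × B) ⟶ (a', b) from (f, 𝟙 b)))
  exact ⟨((IsLimit.postcomposeHomEquiv e _).symm h).ofIsoLimit
    (Cone.ext (Iso.refl _) (fun a => (Category.id_comp _).symm))⟩

/-- After `R.iso` cancels, both composites are represented at `s` by the leg of `K` at `(a, s)`. -/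
theorem LevelRep.isComparison_id (R : LevelRep X) (K : Cocone R.columns) :
    IsComparison (R.colimLim K) (R.limColim K) (𝟙 ((level (A × R.I)).obj K.pt)) := by
  intro a b
  refine (congrArg (fun z => (R.colimLim K).cocone.ι.app b ≫ z) (Category.id_comp _)).trans ?_
  change (level (A × R.I)).map (K.ι.app b) ≫ (levelCone K.pt).π.app a =
    (R.fromColumn.app (a, b) ≫ R.iso.inv.app (a, b)) ≫ R.iso.hom.app (a, b) ≫
      (level R.I).map ((R.toColumn K).app (a, b))
  rw [Category.assoc, Iso.inv_hom_id_app_assoc]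
  refine Pro.hom_ext fun s => ?_
  refine (Germ.res_comp _ _ _).trans (Eq.trans ?_ (Germ.res_comp _ _ _).symm)
  refine (congrArg (Germ.res _) (levelCone_π_res K.pt a s (𝟙 _))).trans ?_
  refine Eq.trans ?_ (congrArg (Germ.res (R.fromColumn.app (a, b)))
    (level_map_res ((R.toColumn K).app (a, b)) s (𝟙 _)).symm)
  exact (levelCone_π_res (R.columns.obj b) a s _).symm

variable [FinCategory B]

theorem LevelRep.isColimit_limColim_cocone (R : LevelRep X) {K : Cocone R.columns}
    (hK : IsLevelwiseColimit K) (a : A) : Nonempty (IsColimit ((R.limColim K).cocone a)) := by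
  let Y : B ⥤ R.I ⥤ C := R.columns ⋙ Functor.curry ⋙ (evaluation _ _).obj a
  let L : Cocone Y := (Functor.curry ⋙ (evaluation A (R.I ⥤ C)).obj a).mapCocone K
  have hL : IsLevelwiseColimit L := fun s => ⟨((hK (a, s)).some)⟩
  obtain ⟨h⟩ := hL.isColimit_level
  let e : (Functor.curry.obj X).obj a ≅ Y ⋙ level R.I :=
    NatIso.ofComponents (fun b => R.iso.app (a, b)) (fun {b b'} f =>
      R.iso.hom.naturality (show ((a, b) : A × B) ⟶ (a, b') from (𝟙 a, f)))
  exact ⟨((IsColimit.precomposeHomEquiv e _).symm h).ofIsoColimit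
    (Cocone.ext (Iso.refl _) (fun b => Category.comp_id _))⟩

theorem LevelRep.isUniversal_limColim (R : LevelRep X) {K : Cocone R.columns}
    (hK : IsLevelwiseColimit K) : (R.limColim K).IsUniversal :=
  ⟨R.isColimit_limColim_cocone hK, (isGermLimit_levelCone K.pt).isLimit⟩

theorem LevelRep.isUniversal_colimLim (R : LevelRep X) {K : Cocone R.columns}
    (hK : IsLevelwiseColimit K) : (R.colimLim K).IsUniversal :=
  ⟨R.isLimit_colimLim_cone K, hK.isColimit_level⟩

end LevelReps

/-! ### Replacing a cofiltered category by a cofinite directed set -/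

section Cofinite

open IsCardinalFiltered.exists_cardinal_directed

/-- A smaller diagram is determined by which of the finitely many arrows and objects of `D` it
contains. -/
theorem finite_Iic_diagramWithUniqueTerminal {J : Type w} [SmallCategory J]
    (D : DiagramWithUniqueTerminal J Cardinal.aleph0) : (Set.Iic D).Finite := by
  have : Finite D.W.toSet := (hasCardinalLT_aleph0_iff _).1 D.hW
  have : Finite (Subtype D.P) := (hasCardinalLT_aleph0_iff _).1 D.hP
  let φ : Set.Iic D → Set D.W.toSet × Set (Subtype D.P) := fun E =>
    ({f | f.1 ∈ E.1.W.toSet}, {j | E.1.P j.1})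
  refine Finite.of_injective φ fun E E' h => Subtype.ext ?_
  obtain ⟨h₁, h₂⟩ := Prod.ext_iff.1 h
  refine DiagramWithUniqueTerminal.ext _ _ ?_ ?_
  · ext i j f
    exact ⟨fun hf => (Set.ext_iff.1 h₁ ⟨Arrow.mk f, E.2.1 _ hf⟩).1 hf,
      fun hf => (Set.ext_iff.1 h₁ ⟨Arrow.mk f, E'.2.1 _ hf⟩).2 hf⟩
  · ext j
    exact ⟨fun hj => (Set.ext_iff.1 h₂ ⟨j, E.2.2 _ hj⟩).1 hj,
      fun hj => (Set.ext_iff.1 h₂ ⟨j, E'.2.2 _ hj⟩).2 hj⟩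

attribute [local instance] Cardinal.fact_isRegular_aleph0 in
/-- Every small cofiltered category `A` receives an initial functor from a codirected partially
ordered set in which every element has finitely many upper bounds. -/
theorem exists_initial_of_cofinite (A : Type v) [SmallCategory A] [IsCofiltered A] :
    ∃ (A' : Type v) (_ : PartialOrder A') (_ : IsCofiltered A')
      (_ : ∀ a : A', (Set.Ici a).Finite) (T : A' ⥤ A), T.Initial := by
  let κ : Cardinal.{v} := Cardinal.aleph0
  have := (isCardinalFiltered_aleph0_iff.{v} Aᵒᵖ).2 inferInstance
  have : IsFiltered κ.ord.ToType := isFiltered_of_isCardinalFiltered κ.ord.ToType κ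
  -- The factor of order type `ω` ensures that each object maps to one with no arrow back, as the
  -- construction of the directed set requires; it is projected away in `F`.
  let J := Aᵒᵖ × κ.ord.ToType
  have hJ : ∀ e : J, ∃ (m : J) (_ : e ⟶ m), IsEmpty (m ⟶ e) := fun ⟨j, x⟩ =>
    ⟨⟨j, Order.succ x⟩, (𝟙 _, homOfLE (Order.le_succ x)), ⟨fun ⟨_, f⟩ => by
      have : NoMaxOrder κ.ord.ToType :=
        Cardinal.noMaxOrder (Cardinal.IsRegular.aleph0_le Fact.out)
      exact not_isMax _ (Order.max_of_succ_le (leOfHom f))⟩⟩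
  let α := DiagramWithUniqueTerminal J κ
  have : IsCardinalFiltered α κ := isCardinalFiltered J κ hJ
  have : IsFiltered α := by rwa [← isCardinalFiltered_aleph0_iff.{v}]
  have : (functor J κ).Final := final_functor J κ hJ
  let F : α ⥤ Aᵒᵖ := functor J κ ⋙ CategoryTheory.Prod.fst _ _
  have : F.Final := inferInstance
  have : IsCofiltered αᵒᵈ := IsCofiltered.of_equivalence (orderDualEquivalence α).symm
  refine ⟨αᵒᵈ, inferInstance, inferInstance, fun a => ?_,
    (orderDualEquivalence α).functor ⋙ F.leftOp, inferInstance⟩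
  exact finite_Iic_diagramWithUniqueTerminal (OrderDual.ofDual a)

end Cofinite

/-! ### Recursion with conditions -/

section Recursion

/-- Well-founded recursion for a family which has to satisfy a condition at each stage. -/
theorem exists_forall_of_wellFounded {α : Type u₁} {r : α → α → Prop} (wf : WellFounded r)
    {S : α → Type u₂} (Φ : ∀ d, (∀ e, r e d → S e) → S d → Prop)
    (h : ∀ d prior, ∃ s, Φ d prior s) : ∃ s : ∀ d, S d, ∀ d, Φ d (fun e _ => s e) (s d) := by
  choose F hF using h
  refine ⟨wf.fix F, fun d => ?_⟩
  have h := hF d (fun e _ => wf.fix F e)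
  rwa [← wf.fix_eq F d] at h

end Recursion

/-! ### Models: lifts of a diagram of pro-objects to `C` -/

variable {C : Type u} [Category.{v} C] {D : Type v} [SmallCategory D]

/-- A lift of the diagram `X` of pro-objects to a diagram in `C`, whose value at `d` is a term
`X_(idx d)` of the pro-object `X d` and whose maps represent the maps of `X`. -/
structure Model (X : D ⥤ Pro C) where
  idx : ∀ d, (X.obj d).Idx
  map : ∀ {d e : D} (_ : d ⟶ e),
    (X.obj d).diag.obj (idx d) ⟶ (X.obj e).diag.obj (idx e)
  map_id : ∀ d, map (𝟙 d) = 𝟙 _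
  map_comp : ∀ {d e e' : D} (f : d ⟶ e) (g : e ⟶ e'), map (f ≫ g) = map f ≫ map g
  rep : ∀ {d e : D} (f : d ⟶ e),
    Germ.mk (X.obj d) (idx d) (map f) = (Germ.proj (X.obj e) (idx e)).res (X.map f)

namespace Model

variable {X : D ⥤ Pro C}

/-- A morphism of models is a natural transformation under `X`. -/
@[ext]
structure Hom (i j : Model X) : Type v where
  app : ∀ d, (X.obj d).diag.obj (i.idx d) ⟶ (X.obj d).diag.obj (j.idx d)
  naturality : ∀ {d e : D} (f : d ⟶ e), i.map f ≫ app e = app d ≫ j.map f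
  rep : ∀ d, Germ.mk (X.obj d) (i.idx d) (app d) = Germ.proj (X.obj d) (j.idx d)

instance : SmallCategory (Model X) where
  Hom := Hom
  id i :=
    { app := fun _ => 𝟙 _
      naturality := fun _ => by simp
      rep := fun _ => rfl }
  comp η θ :=
    { app := fun d => η.app d ≫ θ.app d
      naturality := fun f => by
        rw [← Category.assoc, η.naturality, Category.assoc, θ.naturality, Category.assoc]
      rep := fun d => by
        rw [← Germ.push_mk, η.rep, Germ.proj_push, θ.rep] }
  id_comp η := Hom.ext (funext fun d => Category.id_comp _)
  comp_id η := Hom.ext (funext fun d => Category.comp_id _)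
  assoc η θ ζ := Hom.ext (funext fun d => Category.assoc _ _ _)

/-- The component at `d` of a morphism of models. -/
def comp {i j : Model X} (η : i ⟶ j) (d : D) :
    (X.obj d).diag.obj (i.idx d) ⟶ (X.obj d).diag.obj (j.idx d) := Hom.app η d

theorem comp_naturality {i j : Model X} (η : i ⟶ j) {d e : D} (f : d ⟶ e) :
    i.map f ≫ comp η e = comp η d ≫ j.map f := Hom.naturality η f

theorem comp_rep {i j : Model X} (η : i ⟶ j) (d : D) :
    Germ.mk (X.obj d) (i.idx d) (comp η d) = Germ.proj (X.obj d) (j.idx d) := Hom.rep η d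

end Model

/-! ### Construction of models over cofinite direct shapes -/

/-- There is an arrow from `d` to `e`, and `e` is not `d`. -/
def Below (e d : D) : Prop := Nonempty (d ⟶ e) ∧ e ≠ d

/-- A category in which every object is the source of finitely many arrows, every endomorphism is
an identity, and distinct objects are not connected by arrows in both directions. -/
structure IsCofiniteDirect (D : Type v) [SmallCategory D] : Prop where
  loopless : IsLoopless D
  finite : ∀ d : D, Finite (Σ e, (d ⟶ e))
  antisymm : ∀ {d e : D} (_ : d ⟶ e) (_ : e ⟶ d), d = e

/-- The number of objects reachable from `d` strictly drops along a nontrivial arrow, since `d`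
itself is no longer reachable. -/
theorem IsCofiniteDirect.wellFounded_below (hD : IsCofiniteDirect D) :
    WellFounded (Below (D := D)) := by
  have hfin : ∀ d : D, {e | Nonempty (d ⟶ e)}.Finite := fun d => by
    have := hD.finite d
    refine (Set.finite_range fun x : Σ e, (d ⟶ e) => x.1).subset ?_
    rintro e ⟨f⟩
    exact ⟨⟨e, f⟩, rfl⟩
  refine Subrelation.wf (r := InvImage (· < ·) fun d : D => {e | Nonempty (d ⟶ e)}.ncard) ?_
    (InvImage.wf _ wellFounded_lt)
  rintro e d ⟨⟨f⟩, hne⟩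
  refine Set.ncard_lt_ncard ⟨?_, fun h => ?_⟩ (hfin d)
  · rintro e' ⟨g⟩
    exact ⟨f ≫ g⟩
  · obtain ⟨g⟩ := h ⟨𝟙 d⟩
    exact hne (hD.antisymm g f)

/-- One step of the construction of a model: an index of `X d` over a given one, and
representatives for some of the maps from `X d` to terms of other values of `X`. -/
structure Stage (X : D ⥤ Pro C) (t₀ : ∀ d, (X.obj d).Idx) (d : D) where
  idx : (X.obj d).Idx
  arr : idx ⟶ t₀ d
  map : ∀ {e : D} (f : d ⟶ e) (t : (X.obj e).Idx),
    Option {p : (X.obj d).diag.obj idx ⟶ (X.obj e).diag.obj t //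
      Germ.mk (X.obj d) idx p = (Germ.proj (X.obj e) t).res (X.map f)}

/-- The condition on a stage at `d` relative to the stages below `d`. -/
def Stage.Compatible {X : D ⥤ Pro C} {t₀ : ∀ d, (X.obj d).Idx} {κ : Type} (i : κ → Model X)
    (p : ∀ d k, t₀ d ⟶ (i k).idx d) (d : D) (prior : ∀ e, Below e d → Stage X t₀ e)
    (s : Stage X t₀ d) : Prop :=
  ∃ q : ∀ (e : D) (h : Below e d) (f : d ⟶ e),
      {q : (X.obj d).diag.obj s.idx ⟶ (X.obj e).diag.obj (prior e h).idx //
        Germ.mk (X.obj d) s.idx q = (Germ.proj (X.obj e) (prior e h).idx).res (X.map f)},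
    (∀ e h f, s.map f (prior e h).idx = some (q e h f)) ∧
    (∀ e h f k, (q e h f).1 ≫ (X.obj e).diag.map ((prior e h).arr ≫ p e k) =
      (X.obj d).diag.map (s.arr ≫ p d k) ≫ (i k).map f) ∧
    (∀ e h f e' h' (g : e ⟶ e') y, (prior e h).map g (prior e' h').idx = some y →
      (q e h f).1 ≫ y.1 = (q e' h' (f ≫ g)).1)

/-- Since `Stage` records maps to all indices `t`, as options, its type does not depend on earlier
choices, and the recursion may run over arbitrary `prior`. Three successive restrictions suffice: to
represent the maps (`t₁`), to agree with the given models (`t₂`), and to respect composition with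
recorded maps (`t₃`). Each handles finitely many conditions already true as germs. -/
theorem Stage.exists_compatible (hD : IsCofiniteDirect D) {X : D ⥤ Pro C}
    {t₀ : ∀ d, (X.obj d).Idx} {κ : Type} [Finite κ] (i : κ → Model X)
    (p : ∀ d k, t₀ d ⟶ (i k).idx d) (d : D) (prior : ∀ e, Below e d → Stage X t₀ e) :
    ∃ s : Stage X t₀ d, s.Compatible i p d prior := by
  classical
  let ι := {x : Σ e, (d ⟶ e) // Below x.1 d}
  have := hD.finite
  obtain ⟨t₁, a₁, q₁, hq₁⟩ := Germ.exists_common_rep (t₀ d) fun x : ι =>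
    (Germ.proj (X.obj x.1.1) (prior x.1.1 x.2).idx).res (X.map x.1.2)
  obtain ⟨t₂, a₂, h₂⟩ := Germ.exists_map_eq (t := t₁)
    (fun x : ι × κ => q₁ x.1 ≫ (X.obj x.1.1.1).diag.map ((prior _ x.1.2).arr ≫ p _ x.2))
    (fun x : ι × κ => (X.obj d).diag.map (a₁ ≫ p d x.2) ≫ (i x.2).map x.1.1.2)
    (fun ⟨x, k⟩ => by
      rw [← Germ.push_mk, hq₁, ← Germ.res_push, Germ.proj_push, Germ.mk_map, (i k).rep]
      congr 1
      have := Germ.mk_map (X := X.obj x.1.1) ((prior _ x.2).arr ≫ p _ k) (𝟙 _)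
      rwa [Category.comp_id] at this)
  obtain ⟨t₃, a₃, h₃⟩ := exists_forall_of_cofiltered t₂
    (fun (x : Σ x : ι, {y : Σ e', (x.1.1 ⟶ e') // Below y.1 d}) r a =>
      ∀ y, (prior _ x.1.2).map x.2.1.2 (prior _ x.2.2).idx = some y →
        (X.obj d).diag.map (a ≫ a₂) ≫ q₁ x.1 ≫ y.1 =
          (X.obj d).diag.map (a ≫ a₂) ≫ q₁ ⟨⟨x.2.1.1, x.1.1.2 ≫ x.2.1.2⟩, x.2.2⟩)
    (fun x r a r' b h y hy => by
      have := h y hy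
      simp only [Functor.map_comp, Category.assoc] at this ⊢
      rw [this])
    (fun x => by
      rcases hy : (prior _ x.1.2).map x.2.1.2 (prior _ x.2.2).idx with _ | y
      -- Where nothing was recorded there is no condition.
      · exact ⟨t₂, 𝟙 _, fun y hy => by cases hy⟩
      · obtain ⟨r, a, h⟩ := Germ.mk_eq_mk_iff (X := X.obj d) (t := t₂)
          (f := (X.obj d).diag.map a₂ ≫ q₁ x.1 ≫ y.1)
          (g := (X.obj d).diag.map a₂ ≫ q₁ ⟨⟨x.2.1.1, x.1.1.2 ≫ x.2.1.2⟩, x.2.2⟩) |>.1 (by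
            rw [Germ.mk_map, Germ.mk_map, ← Germ.push_mk, hq₁, hq₁, ← Germ.res_push,
              Germ.proj_push, y.2, X.map_comp, Germ.res_comp])
        refine ⟨r, a, fun y' hy' => ?_⟩
        obtain rfl := Option.some.inj hy'
        simpa using h)
  have hq : ∀ (e : D) (h : Below e d) (f : d ⟶ e),
      Germ.mk (X.obj d) t₃ ((X.obj d).diag.map (a₃ ≫ a₂) ≫ q₁ ⟨⟨e, f⟩, h⟩) =
        (Germ.proj (X.obj e) (prior e h).idx).res (X.map f) := fun e h f => by
    rw [Germ.mk_map, hq₁]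
  -- Maps are recorded at the indices chosen by the earlier stages; `none` is the default everywhere
  -- else.
  refine ⟨{ idx := t₃, arr := a₃ ≫ a₂ ≫ a₁, map := fun {e} f t =>
      if h : ∃ h : Below e d, (prior e h).idx = t then
        some (h.choose_spec ▸ ⟨_, hq e h.choose f⟩) else none },
    fun e h f => ⟨_, hq e h f⟩, ?_, ?_, ?_⟩
  · intro e h f
    exact dif_pos (⟨h, rfl⟩ : ∃ h' : Below e d, (prior e h').idx = (prior e h).idx)
  · intro e h f k
    have := h₂ ⟨⟨⟨e, f⟩, h⟩, k⟩
    simp only [Functor.map_comp, Category.assoc] at this ⊢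
    rw [this]
  · intro e h f e' h' g y hy
    have := h₃ ⟨⟨⟨e, f⟩, h⟩, ⟨⟨e', g⟩, h'⟩⟩ y hy
    simpa only [Category.assoc] using this

/-- Finitely many models, with common refinements `t₀ d` of their indices at every `d`, are
refined by a model with indices over the `t₀ d`. -/
theorem Model.exists_refinement (hD : IsCofiniteDirect D) {X : D ⥤ Pro C}
    (t₀ : ∀ d, (X.obj d).Idx) {κ : Type} [Finite κ] (i : κ → Model X)
    (p : ∀ d k, t₀ d ⟶ (i k).idx d) :
    ∃ (z : Model X) (a : ∀ d, z.idx d ⟶ t₀ d) (η : ∀ k, z ⟶ i k),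
      ∀ k d, Model.comp (η k) d = (X.obj d).diag.map (a d ≫ p d k) := by
  classical
  obtain ⟨s, hs⟩ := exists_forall_of_wellFounded hD.wellFounded_below
    (fun d prior s => Stage.Compatible i p d prior s) (Stage.exists_compatible hD i p)
  choose q hq₁ hq₂ hq₃ using hs
  have hid : ∀ {d : D} (f : d ⟶ d), f = 𝟙 d := fun f => hD.loopless _ f
  -- The stages provide maps only between distinct objects; looplessness lets the remaining ones be
  -- identities.
  let map : ∀ {d e : D} (_ : d ⟶ e),
      (X.obj d).diag.obj (s d).idx ⟶ (X.obj e).diag.obj (s e).idx := fun {d e} f =>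
    if h : e = d then eqToHom (by rw [h]) else (q d e ⟨⟨f⟩, h⟩ f).1
  have map_self : ∀ {d : D} (f : d ⟶ d), map f = 𝟙 _ := fun f => dif_pos rfl
  have map_ne : ∀ {d e : D} (f : d ⟶ e) (h : e ≠ d), map f = (q d e ⟨⟨f⟩, h⟩ f).1 :=
    fun f h => dif_neg h
  let z : Model X :=
    { idx := fun d => (s d).idx
      map := map
      map_id := fun d => map_self _
      map_comp := fun {d e e'} f g => by
        by_cases h : e = d
        · subst h
          rw [map_self f, hid f, Category.id_comp, Category.id_comp]
        · by_cases h' : e' = e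
          · subst h'
            rw [map_self g, hid g, Category.comp_id, Category.comp_id]
          · have h'' : e' ≠ d := by
              rintro rfl
              exact h (hD.antisymm g f)
            rw [map_ne f h, map_ne g h', map_ne _ h'']
            -- By `hq₁` the stage at `e` recorded the very map chosen for `g`, so the composition
            -- condition at `d` applies to it.
            exact (hq₃ d e ⟨⟨f⟩, h⟩ f e' ⟨⟨f ≫ g⟩, h''⟩ g _ (hq₁ e e' ⟨⟨g⟩, h'⟩ g)).symm
      rep := fun {d e} f => by
        by_cases h : e = d
        · subst h
          rw [map_self f, hid f, X.map_id, Germ.res_id]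
          rfl
        · rw [map_ne f h]
          exact (q d e ⟨⟨f⟩, h⟩ f).2 }
  refine ⟨z, fun d => (s d).arr, fun k =>
    { app := fun d => (X.obj d).diag.map ((s d).arr ≫ p d k)
      naturality := fun {d e} f => ?_
      rep := fun d => ?_ }, fun k d => rfl⟩
  · by_cases h : e = d
    · subst h
      rw [hid f, z.map_id, (i k).map_id, Category.id_comp, Category.comp_id]
    · exact (congrArg (fun m => m ≫ _) (map_ne f h)).trans (hq₂ d e ⟨⟨f⟩, h⟩ f k)
  · have := Germ.mk_map (X := X.obj d) ((s d).arr ≫ p d k) (𝟙 _)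
    rwa [Category.comp_id] at this

theorem Model.isCofiltered (hD : IsCofiniteDirect D) (X : D ⥤ Pro C) :
    IsCofiltered (Model X) := by
  have : Nonempty (Model X) := by
    -- Refining the empty family, over arbitrary indices, produces a model.
    obtain ⟨z, -⟩ := Model.exists_refinement hD (X := X) (κ := Empty)
      (fun d => IsCofiltered.nonempty.some) (fun k => k.elim) (fun d k => k.elim)
    exact ⟨z⟩
  have : IsCofilteredOrEmpty (Model X) :=
    { cone_objs := fun i j => by
        obtain ⟨z, -, η, -⟩ := Model.exists_refinement hD (X := X)
          (fun d => IsCofiltered.min (i.idx d) (j.idx d)) (fun k : Bool => cond k i j)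
          (fun d k => match k with
            | true => IsCofiltered.minToLeft _ _
            | false => IsCofiltered.minToRight _ _)
        exact ⟨z, η true, η false, trivial⟩
      cone_maps := fun i j α β => by
        -- Both components at `d` represent the same projection, so they agree over some `t d`; a
        -- refinement of `i` over these indices equalises the two morphisms.
        choose t a h using fun d => Germ.mk_eq_mk_iff.1
          ((Model.comp_rep α d).trans (Model.comp_rep β d).symm)
        obtain ⟨z, b, η, hη⟩ := Model.exists_refinement hD t (fun _ : Unit => i) (fun d _ => a d)
        refine ⟨z, η (), Model.Hom.ext (funext fun d => ?_)⟩
        change Model.comp (η ()) d ≫ Model.comp α d = Model.comp (η ()) d ≫ Model.comp β d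
        rw [hη, Functor.map_comp, Category.assoc, h, Category.assoc] }
  exact {}

/-! ### The level representation by models -/

/-- The evaluation of models. -/
def Model.diag (X : D ⥤ Pro C) : D × Model X ⥤ C where
  obj x := (X.obj x.1).diag.obj (x.2.idx x.1)
  map {x y} m := Model.comp m.2 x.1 ≫ y.2.map m.1
  map_id x := (Category.id_comp _).trans (x.2.map_id _)
  map_comp {x y z} m m' := by
    change (Model.comp m.2 x.1 ≫ Model.comp m'.2 x.1) ≫ z.2.map (m.1 ≫ m'.1) =
      (Model.comp m.2 x.1 ≫ y.2.map m.1) ≫ Model.comp m'.2 y.1 ≫ z.2.map m'.1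
    rw [Model.map_comp, Category.assoc, Category.assoc, ← Category.assoc (y.2.map m.1),
      Model.comp_naturality, Category.assoc]

theorem Model.diag_map_right (X : D ⥤ Pro C) (d : D) {i j : Model X} (η : i ⟶ j) :
    ((Functor.curry.obj (Model.diag X)).obj d).map η = Model.comp η d := by
  change Model.comp η d ≫ j.map (𝟙 d) = _
  rw [Model.map_id, Category.comp_id]

theorem Model.diag_map_left (X : D ⥤ Pro C) {d e : D} (f : d ⟶ e) (i : Model X) :
    ((Functor.curry.obj (Model.diag X)).map f).app i = i.map f :=
  Category.id_comp _

section

variable (X : D ⥤ Pro C) [IsCofiltered (Model X)]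

/-- The map from `X d` to the pro-object of its terms that belong to a model. -/
def Model.toLevel (d : D) :
    X.obj d ⟶ (Functor.curry.obj (Model.diag X) ⋙ level (Model X)).obj d :=
  Pro.homMk (Y := (level (Model X)).obj ((Functor.curry.obj (Model.diag X)).obj d))
    (fun i => Germ.proj (X.obj d) (i.idx d)) (fun {i j} η => by
      refine (congrArg (Germ.push _) (Model.diag_map_right X d η)).trans ?_
      exact (Germ.proj_push _ _ _).trans (Model.comp_rep η d))

theorem Model.mk_res_toLevel (d : D) (i : Model X) {c : C}
    (f : (X.obj d).diag.obj (i.idx d) ⟶ c) :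
    Germ.res (Model.toLevel X d) (Germ.mk ((level (Model X)).obj
      ((Functor.curry.obj (Model.diag X)).obj d)) i f) = Germ.mk (X.obj d) (i.idx d) f :=
  Germ.proj_push _ _ _

/-- The maps `Model.toLevel` are natural. -/
def Model.toLevelNatTrans : X ⟶ Functor.curry.obj (Model.diag X) ⋙ level (Model X) where
  app d := Model.toLevel X d
  naturality d e f := by
    refine Pro.hom_ext fun i => ?_
    refine (Germ.res_comp _ _ _).trans (Eq.trans ?_ (Germ.res_comp _ _ _).symm)
    refine (congrArg (Germ.res (X.map f)) (Model.mk_res_toLevel X e i (𝟙 _))).trans ?_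
    refine Eq.trans ?_ (congrArg (Germ.res (Model.toLevel X d))
      (level_map_res ((Functor.curry.obj (Model.diag X)).map f) i (𝟙 _)).symm)
    refine Eq.trans ?_ (Model.mk_res_toLevel X d i _).symm
    refine (Model.rep i f).symm.trans (congrArg (Germ.mk (X.obj d) (i.idx d)) ?_)
    exact (Model.diag_map_left X f i).symm.trans (Category.comp_id _).symm

end

/-- Every diagram of pro-objects whose shape is cofinite and direct has a level
representation. -/
theorem exists_levelRep_of_isCofiniteDirect (hD : IsCofiniteDirect D) (X : D ⥤ Pro C) :
    Nonempty (LevelRep X) := by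
  have := Model.isCofiltered hD X
  have hiso : ∀ d, IsIso ((Model.toLevelNatTrans X).app d) := fun d => by
    refine Pro.isIso_of_bijective (Model.toLevel X d) fun c => ⟨fun x y hxy => ?_, fun x => ?_⟩
    · obtain ⟨i, f, g, rfl, rfl⟩ : ∃ (i : Model X) (f g : (X.obj d).diag.obj (i.idx d) ⟶ c),
          Germ.mk ((level (Model X)).obj ((Functor.curry.obj (Model.diag X)).obj d)) i f = x ∧
          Germ.mk ((level (Model X)).obj ((Functor.curry.obj (Model.diag X)).obj d)) i g = y :=
        Germ.exists_rep_pair x y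
      obtain ⟨r, a, h⟩ := Germ.mk_eq_mk_iff.1
        ((Model.mk_res_toLevel X d i f).symm.trans (hxy.trans (Model.mk_res_toLevel X d i g)))
      -- The restriction needed at `d` is extended to all objects by identities, so that `i` can be
      -- refined over it.
      obtain ⟨t, b, hb⟩ : ∃ (t : ∀ e, (X.obj e).Idx) (b : ∀ e, t e ⟶ i.idx e),
          (X.obj d).diag.map (b d) ≫ f = (X.obj d).diag.map (b d) ≫ g := by
        have : ∀ e, ∃ (t : (X.obj e).Idx) (b : t ⟶ i.idx e), ∀ h : d = e,
            (X.obj e).diag.map b ≫ eqToHom (by rw [h]) ≫ f =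
              (X.obj e).diag.map b ≫ eqToHom (by rw [h]) ≫ g := fun e => by
          by_cases hde : d = e
          · subst hde
            exact ⟨r, a, fun _ => by simpa using h⟩
          · exact ⟨_, 𝟙 _, fun h => absurd h hde⟩
        choose t b hb using this
        exact ⟨t, b, by simpa using hb d rfl⟩
      obtain ⟨z, a', η, hη⟩ := Model.exists_refinement hD t (fun _ : Unit => i) (fun e _ => b e)
      refine Germ.mk_eq_mk_iff.2 ⟨z, η (), ?_⟩
      have key : Model.comp (η ()) d ≫ f = Model.comp (η ()) d ≫ g := by
        rw [hη, Functor.map_comp, Category.assoc, hb, Category.assoc]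
      rw [← Model.diag_map_right X d] at key
      exact key
    · obtain ⟨t, f, rfl⟩ := x.exists_rep
      -- A model over `t` at `d`, with arbitrary prescribed indices elsewhere, represents the given
      -- germ.
      obtain ⟨t₀, rfl⟩ : ∃ t₀ : ∀ e, (X.obj e).Idx, t₀ d = t := by
        classical
        exact ⟨Function.update (fun e => IsCofiltered.nonempty.some) d t,
          Function.update_self _ _ _⟩
      obtain ⟨z, a, -⟩ := Model.exists_refinement hD (X := X) (κ := Empty) t₀
        (fun k => k.elim) (fun d k => k.elim)
      exact ⟨Germ.mk ((level (Model X)).obj ((Functor.curry.obj (Model.diag X)).obj d)) z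
        ((X.obj d).diag.map (a d) ≫ f),
        (Model.mk_res_toLevel X d z _).trans (Germ.mk_map (a d) f)⟩
  have : IsIso (Model.toLevelNatTrans X) := NatIso.isIso_of_isIso_app _
  exact ⟨{ I := Model X, diag := Model.diag X, iso := asIso (Model.toLevelNatTrans X) }⟩

/-! ### Cofinite direct shapes -/

section Shapes

theorem IsLoopless.of_faithful {D : Type u₁} [Category.{w₁} D] {E : Type u₂} [Category.{w₂} E]
    (F : D ⥤ E) [F.Faithful] (h : IsLoopless E) : IsLoopless D := fun d _ =>
  F.map_injective ((h _ _).trans (F.map_id d).symm)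

/-- A finite loopless category is equivalent to one in the lowest universe in which distinct
objects are not connected by arrows in both directions. -/
theorem IsLoopless.exists_equivalence {B : Type w} [SmallCategory B] [FinCategory B]
    (hB : IsLoopless B) :
    ∃ (B₀ : Type) (_ : SmallCategory B₀) (_ : IsCofiniteDirect B₀), Nonempty (B ≌ B₀) := by
  let e : Skeleton (FinCategory.AsType B) ≌ B :=
    (skeletonEquivalence (FinCategory.AsType B)).trans (FinCategory.equivAsType B)
  refine ⟨Skeleton (FinCategory.AsType B), inferInstance, ⟨hB.of_faithful e.functor, fun d => ?_,
    fun f g => ?_⟩, ⟨e.symm⟩⟩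
  · have : Finite (Skeleton (FinCategory.AsType B)) :=
      inferInstanceAs (Finite (Quotient (isIsomorphicSetoid (FinCategory.AsType B))))
    have (e' : Skeleton (FinCategory.AsType B)) : Finite (d ⟶ e') :=
      Finite.of_injective _ (e.functor.map_injective (X := d) (Y := e'))
    infer_instance
  · have hl := hB.of_faithful e.functor
    exact skeleton_skeletal _ ⟨⟨f, g, hl _ _, hl _ _⟩⟩

theorem isCofiniteDirect_of_finite_Ici {A : Type v} [PartialOrder A]
    (hA : ∀ a : A, (Set.Ici a).Finite) : IsCofiniteDirect A where
  loopless _ _ := Subsingleton.elim _ _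
  finite a := by
    have := (hA a).to_subtype
    exact Finite.of_injective (β := Set.Ici a) (fun x => ⟨x.1, leOfHom x.2⟩) (by
      rintro ⟨b, f⟩ ⟨b', f'⟩ h
      obtain rfl : b = b' := congrArg Subtype.val h
      exact congrArg _ (Subsingleton.elim _ _))
  antisymm f g := le_antisymm (leOfHom f) (leOfHom g)

theorem IsCofiniteDirect.prod {A : Type v} [SmallCategory A] {B : Type} [SmallCategory B]
    (hA : IsCofiniteDirect A) (hB : IsCofiniteDirect B) : IsCofiniteDirect.{v} (A × B) where
  loopless x f := Prod.ext (hA.loopless _ _) (hB.loopless _ _)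
  finite x := by
    have := hA.finite x.1
    have := hB.finite x.2
    refine Finite.of_injective (β := (Σ a, (x.1 ⟶ a)) × (Σ b, (x.2 ⟶ b)))
      (fun y => (⟨y.1.1, y.2.1⟩, ⟨y.1.2, y.2.2⟩)) ?_
    rintro ⟨⟨a, b⟩, f, g⟩ ⟨⟨a', b'⟩, f', g'⟩ h
    simp only [Prod.mk.injEq, Sigma.mk.injEq] at h
    obtain ⟨⟨rfl, h₁⟩, rfl, h₂⟩ := h
    obtain rfl := eq_of_heq h₁
    obtain rfl := eq_of_heq h₂
    rfl
  antisymm f g := Prod.ext (hA.antisymm f.1 g.1) (hB.antisymm f.2 g.2)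

end Shapes

/-! ### Transport of level representations -/

section LevelReps

variable {C : Type u} [Category.{v} C] {D : Type u₁} [Category.{w₁} D] {E : Type u₂}
  [Category.{w₂} E]

/-- Transport of a level representation along an isomorphism of diagrams. -/
def LevelRep.ofIso {X Y : D ⥤ Pro C} (R : LevelRep X) (e : X ≅ Y) : LevelRep Y where
  I := R.I
  diag := R.diag
  iso := e.symm ≪≫ R.iso

/-- Restriction of a level representation along a functor. -/
def LevelRep.precomp {X : D ⥤ Pro C} (R : LevelRep X) (G : E ⥤ D) : LevelRep (G ⋙ X) where
  I := R.I
  diag := G.prod (𝟭 R.I) ⋙ R.diag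
  iso := Functor.isoWhiskerLeft G R.iso ≪≫
    Functor.isoWhiskerRight (NatIso.ofComponents
      (fun e => NatIso.ofComponents (fun s => Iso.refl _)) : G ⋙ Functor.curry.obj R.diag ≅
        Functor.curry.obj (G.prod (𝟭 R.I) ⋙ R.diag)) (level R.I)

/-- Transport of a level representation along an equivalence of shapes. -/
def LevelRep.ofEquivalence (e : D ≌ E) {X : D ⥤ Pro C} (R : LevelRep (e.inverse ⋙ X)) :
    LevelRep X :=
  (R.precomp e.functor).ofIso (e.funInvIdAssoc X)

theorem exists_levelRep_prod {A : Type v} [PartialOrder A] (hA : ∀ a : A, (Set.Ici a).Finite)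
    {B : Type w} [SmallCategory B] [FinCategory B] (hB : IsLoopless B) (X : A × B ⥤ Pro C) :
    Nonempty (LevelRep X) := by
  obtain ⟨B₀, _, hB₀, ⟨e⟩⟩ := hB.exists_equivalence
  let e' : A × B ≌ A × B₀ := CategoryTheory.Equivalence.prod CategoryTheory.Equivalence.refl e
  obtain ⟨R⟩ := exists_levelRep_of_isCofiniteDirect
    ((isCofiniteDirect_of_finite_Ici hA).prod hB₀) (e'.inverse ⋙ X)
  exact ⟨R.ofEquivalence e'⟩

end LevelReps

/-! ### Existence of cofiltered limits -/

section Limits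

variable {C : Type u} [Category.{v} C] {A : Type v} [SmallCategory A]

theorem LevelRep.exists_isGermLimit [IsCofiltered A] {F : A ⥤ Pro C} (R : LevelRep F) :
    ∃ t : Cone F, IsGermLimit t := by
  refine ⟨(Cone.postcompose R.iso.inv).obj (levelCone R.diag), ?_, ?_⟩
  · intro c g
    obtain ⟨a, x, hx⟩ := (isGermLimit_levelCone R.diag).exists_res g
    refine ⟨a, x.res (R.iso.hom.app a), ?_⟩
    refine Eq.trans ?_ hx
    change Germ.res (leg (levelCone R.diag) a ≫ R.iso.inv.app a) _ = _
    rw [Germ.res_comp, ← Germ.res_comp (R.iso.inv.app a), Iso.inv_hom_id_app]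
    exact congrArg (Germ.res _) (Germ.res_id _)
  · intro c a x y h
    change Germ.res (leg (levelCone R.diag) a ≫ R.iso.inv.app a) x =
      Germ.res (leg (levelCone R.diag) a ≫ R.iso.inv.app a) y at h
    rw [Germ.res_comp, Germ.res_comp] at h
    obtain ⟨a', f, hf⟩ := (isGermLimit_levelCone R.diag).exists_map_res a _ _ h
    refine ⟨a', f, ?_⟩
    have := congrArg (Germ.res (R.iso.hom.app a')) hf
    rwa [← Germ.res_comp, ← Germ.res_comp, ← Germ.res_comp, ← Germ.res_comp,
      Category.assoc,
      R.iso.inv.naturality, Iso.hom_inv_id_app_assoc] at this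

/-- An equality of germs over `a` is first moved to some `T a' ⟶ a`, which exists by initiality. -/
theorem IsGermLimit.of_initial {A' : Type v} [SmallCategory A'] [IsCofiltered A'] (T : A' ⥤ A)
    [IsCofiltered A] [T.Initial] {F : A ⥤ Pro C} {t : Cone F} (ht : IsGermLimit (t.whisker T)) :
    IsGermLimit t := by
  constructor
  · intro c g
    obtain ⟨a, x, hx⟩ := ht.exists_res g
    exact ⟨T.obj a, x, hx⟩
  · intro c a x y h
    obtain ⟨a', ⟨f⟩⟩ := (Functor.initial_iff_of_isCofiltered T).1 inferInstance |>.1 a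
    obtain ⟨a'', f', hf⟩ := ht.exists_map_res a' (x.res (F.map f)) (y.res (F.map f)) (by
      change Germ.res (leg t (T.obj a')) _ = Germ.res (leg t (T.obj a')) _
      rw [← Germ.res_comp, ← Germ.res_comp, leg_map]
      exact h)
    refine ⟨T.obj a'', T.map f' ≫ f, ?_⟩
    rw [F.map_comp, Germ.res_comp, Germ.res_comp]
    exact hf

variable [IsCofiltered A]

/-- One germ limit over the cofinite replacement gives existence, and uniqueness of limits carries
the germ description to every limit cone. -/
theorem hasLimit_and_isGermLimit (F : A ⥤ Pro C) :
    HasLimit F ∧ ∀ (t : Cone F), IsLimit t → IsGermLimit t := by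
  obtain ⟨A', _, _, hA', T, _⟩ := exists_initial_of_cofinite A
  obtain ⟨R⟩ := exists_levelRep_of_isCofiniteDirect (isCofiniteDirect_of_finite_Ici hA') (T ⋙ F)
  obtain ⟨s, hs⟩ := R.exists_isGermLimit
  obtain ⟨hs'⟩ := hs.isLimit
  have : HasLimit (T ⋙ F) := ⟨⟨⟨s, hs'⟩⟩⟩
  exact ⟨Functor.Initial.hasLimit_of_comp T, fun t ht => IsGermLimit.of_initial T
    (hs.of_isLimit hs' ((Functor.Initial.isLimitWhiskerEquiv T t).symm ht))⟩

instance : HasLimitsOfShape A (Pro C) := ⟨fun F => (hasLimit_and_isGermLimit F).1⟩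

theorem isGermLimit_of_isLimit {F : A ⥤ Pro C} {t : Cone F} (ht : IsLimit t) : IsGermLimit t :=
  (hasLimit_and_isGermLimit F).2 t ht

end Limits

/-! ### Pointwise limits and colimits -/

section Pointwise

variable {A : Type u₁} [Category.{w₁} A] {B : Type u₂} [Category.{w₂} B] {D : Type u₃}
  [Category.{w} D]

/-- The projections from the pointwise limits `lim_a X (a, b)` to the `X (a, b)`. -/
noncomputable def limProj [HasLimitsOfShape A D] (X : A × B ⥤ D) :
    CategoryTheory.Prod.snd A B ⋙
      Functor.curry.obj (CategoryTheory.Prod.swap B A ⋙ X) ⋙ Limits.lim ⟶ X where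
  app x := limit.π ((Functor.curry.obj (CategoryTheory.Prod.swap B A ⋙ X)).obj x.2) x.1
  naturality x y f := by
    refine (limMap_π _ _).trans ?_
    refine Eq.trans ?_ (congrArg (fun k => limit.π ((Functor.curry.obj
      (CategoryTheory.Prod.swap B A ⋙ X)).obj x.2) x.1 ≫ k)
      ((X.map_comp (show x ⟶ (y.1, x.2) from (f.1, 𝟙 x.2))
        (show (y.1, x.2) ⟶ y from (𝟙 y.1, f.2))).symm.trans (congrArg (fun k => X.map k)
          (Prod.ext (Category.comp_id f.1) (Category.id_comp f.2)))))
    rw [← Category.assoc]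
    exact congrArg (fun k => k ≫ _) (limit.w ((Functor.curry.obj
      (CategoryTheory.Prod.swap B A ⋙ X)).obj x.2) f.1).symm

theorem isLimit_coneAt_limProj [HasLimitsOfShape A D]
    (X : A × B ⥤ D) (b : B) : Nonempty (IsLimit (coneAt (limProj X) b)) :=
  ⟨(limit.isLimit _).ofIsoLimit (Cone.ext (Iso.refl _) (fun _ => (Category.id_comp _).symm))⟩

/-- The injections from the `X (a, b)` to the pointwise colimits `colim_b X (a, b)`. -/
noncomputable def colimInj [HasColimitsOfShape B D]
    (X : A × B ⥤ D) :
    X ⟶ CategoryTheory.Prod.fst A B ⋙ Functor.curry.obj X ⋙ colim where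
  app x := colimit.ι ((Functor.curry.obj X).obj x.1) x.2
  naturality x y f := by
    refine Eq.trans ?_ (ι_colimMap ((Functor.curry.obj X).map f.1) x.2).symm
    refine (congrArg (fun k => k ≫ colimit.ι ((Functor.curry.obj X).obj y.1) y.2)
      ((X.map_comp (show x ⟶ (y.1, x.2) from (f.1, 𝟙 x.2))
        (show (y.1, x.2) ⟶ y from (𝟙 y.1, f.2))).symm.trans (congrArg (fun k => X.map k)
          (Prod.ext (Category.comp_id f.1) (Category.id_comp f.2)))).symm).trans ?_
    rw [Category.assoc]
    exact congrArg (fun k => _ ≫ k) (colimit.w ((Functor.curry.obj X).obj y.1) f.2)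

end Pointwise

/-! ### Cofiltered limits commute with finite colimits -/

section Commutation

variable {C : Type u} [Category.{v} C] {A : Type v} [SmallCategory A] [IsCofiltered A]
  {B : Type w} [SmallCategory B] [FinCategory B] {X : A × B ⥤ Pro C}

theorem LimColim.IsUniversal.isColimit_comparisonCocone {P : LimColim X} (hP : P.IsUniversal)
    {L : B ⥤ Pro C} (π : CategoryTheory.Prod.snd A B ⋙ L ⟶ X)
    (hπ : ∀ b, Nonempty (IsLimit (coneAt π b))) :
    Nonempty (IsColimit (comparisonCocone π hP.2.some)) :=
  (isGermColimit_comparisonCocone _ (isGermLimit_of_isLimit hP.2.some)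
    (fun a => isGermColimit_of_isColimit (hP.1 a).some) π
    (fun b => isGermLimit_of_isLimit (hπ b).some)).isColimit

theorem exists_iso_isComparison {P : LimColim X} (hP : P.IsUniversal) {Q : ColimLim X}
    (hQ : Q.IsUniversal) : ∃ f : Q.cocone.pt ≅ P.cone.pt, IsComparison Q P f.hom :=
  Q.exists_iso_of_isColimit hP.2.some (hP.isColimit_comparisonCocone Q.π hQ.1).some hQ.2.some

theorem LimColim.IsUniversal.exists_colimLim {P : LimColim X} (hP : P.IsUniversal) :
    ∃ Q : ColimLim X, Q.IsUniversal :=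
  ⟨{ lim := _, π := limProj X, cocone := comparisonCocone (limProj X) hP.2.some },
    isLimit_coneAt_limProj X, hP.isColimit_comparisonCocone _ (isLimit_coneAt_limProj X)⟩

theorem isIso_colimitLimitToLimitColimit [HasLimitsOfShape A (Pro C)]
    [HasColimitsOfShape B (Pro C)] (X : A × B ⥤ Pro C) :
    IsIso (colimitLimitToLimitColimit X) := by
  let P : LimColim X :=
    { col := _, ι := colimInj X, cone := limit.cone (Functor.curry.obj X ⋙ colim) }
  let Q : ColimLim X :=
    { lim := _, π := limProj X, cocone := colimit.cocone _ }
  have hP : P.IsUniversal :=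
    ⟨fun a => ⟨(colimit.isColimit _).ofIsoColimit
      (Cocone.ext (Iso.refl _) (fun b => Category.comp_id _))⟩, ⟨limit.isLimit _⟩⟩
  have hQ : Q.IsUniversal := ⟨isLimit_coneAt_limProj X, ⟨colimit.isColimit _⟩⟩
  obtain ⟨f, hf⟩ := exists_iso_isComparison hP hQ
  have : colimitLimitToLimitColimit X = f.hom := by
    refine colimit.hom_ext fun b => limit.hom_ext fun a => ?_
    rw [Category.assoc, Category.assoc, ι_colimitLimitToLimitColimit_π]
    exact (hf a b).symm
  rw [this]
  infer_instance

end Commutation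

/-! ### Restriction along an initial functor -/

section Restriction

variable {C : Type u} [Category.{v} C] {A A' : Type v} [SmallCategory A] [SmallCategory A']
  {B : Type w} [SmallCategory B] {X : A × B ⥤ Pro C}

/-- Restriction of an iterated `lim_a colim_b` along a functor. -/
def LimColim.restrict (P : LimColim X) (T : A' ⥤ A) : LimColim (T.prod (𝟭 B) ⋙ X) where
  col := T ⋙ P.col
  ι := Functor.whiskerLeft (T.prod (𝟭 B)) P.ι
  cone := P.cone.whisker T

/-- Restriction of an iterated `colim_b lim_a` along a functor. -/
def ColimLim.restrict (Q : ColimLim X) (T : A' ⥤ A) : ColimLim (T.prod (𝟭 B) ⋙ X) where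
  lim := Q.lim
  π := Functor.whiskerLeft (T.prod (𝟭 B)) Q.π
  cocone := Q.cocone

variable (T : A' ⥤ A)

/-- Restriction along `T` commutes with restriction to columns. -/
def restrictRowIso (X : A × B ⥤ Pro C) (a : A') :
    (Functor.curry.obj (T.prod (𝟭 B) ⋙ X)).obj a ≅ (Functor.curry.obj X).obj (T.obj a) :=
  NatIso.ofComponents (fun b => Iso.refl _) (fun {b b'} f => by
    refine (Category.comp_id _).trans (Eq.trans ?_ (Category.id_comp _).symm)
    exact congrArg (fun k => X.map k) (Prod.ext (T.map_id a) rfl))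

/-- Restriction along `T` commutes with restriction to rows. -/
def restrictColumnIso (X : A × B ⥤ Pro C) (b : B) :
    T ⋙ (Functor.curry.obj (CategoryTheory.Prod.swap B A ⋙ X)).obj b ≅
      (Functor.curry.obj (CategoryTheory.Prod.swap B A' ⋙ T.prod (𝟭 B) ⋙ X)).obj b :=
  NatIso.ofComponents (fun b => Iso.refl _)

variable [T.Initial]

theorem LimColim.IsUniversal.restrict {P : LimColim X} (hP : P.IsUniversal) :
    (P.restrict T).IsUniversal := by
  refine ⟨fun a => ?_, ⟨(Functor.Initial.isLimitWhiskerEquiv T _).symm hP.2.some⟩⟩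
  exact ⟨((IsColimit.precomposeHomEquiv (restrictRowIso T X a) _).symm
    (hP.1 (T.obj a)).some).ofIsoColimit (Cocone.ext (Iso.refl _)
      (fun b => (Category.comp_id _).trans (Category.id_comp _)))⟩

theorem ColimLim.IsUniversal.restrict {Q : ColimLim X} (hQ : Q.IsUniversal) :
    (Q.restrict T).IsUniversal := by
  refine ⟨fun b => ?_, hQ.2⟩
  exact ⟨((IsLimit.postcomposeHomEquiv (restrictColumnIso T X b) _).symm
    ((Functor.Initial.isLimitWhiskerEquiv T _).symm (hQ.1 b).some)).ofIsoLimit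
      (Cone.ext (Iso.refl _) (fun b =>
        (Category.comp_id _).trans (Category.id_comp _).symm))⟩

end Restriction

/-! ### Finite colimits of pro-objects -/

section FiniteColimits

variable {C : Type u} [Category.{v} C]

theorem exists_isLevelwiseColimit {B : Type u₂} [Category.{w₂} B] [HasColimitsOfShape B C]
    {J : Type u₁} [Category.{w₁} J] (Y : B ⥤ J ⥤ C) : ∃ K : Cocone Y, IsLevelwiseColimit K :=
  ⟨colimit.cocone Y, fun j =>
    ⟨isColimitOfPreserves ((evaluation J C).obj j) (colimit.isColimit Y)⟩⟩

theorem hasColimitsOfShape_of_isLoopless {B : Type w} [SmallCategory B] [FinCategory B]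
    (hB : IsLoopless B) [HasColimitsOfShape B C] : HasColimitsOfShape B (Pro C) where
  has_colimit X := by
    have hfin : ∀ a : PUnit.{v + 1}, (Set.Ici a).Finite := fun a => Set.toFinite _
    -- A `B`-diagram is viewed as a `PUnit × B`-diagram, and the levelwise colimit is read off at
    -- the point.
    obtain ⟨R⟩ := exists_levelRep_prod hfin hB (CategoryTheory.Prod.snd PUnit.{v + 1} B ⋙ X)
    obtain ⟨K, hK⟩ := exists_isLevelwiseColimit R.columns
    obtain ⟨h⟩ := R.isColimit_limColim_cocone hK PUnit.unit
    let e : (Functor.curry.obj (CategoryTheory.Prod.snd PUnit.{v + 1} B ⋙ X)).obj PUnit.unit ≅ X :=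
      NatIso.ofComponents (fun b => Iso.refl _)
    have : HasColimit ((Functor.curry.obj (CategoryTheory.Prod.snd PUnit.{v + 1} B ⋙ X)).obj
      PUnit.unit) := ⟨⟨⟨_, h⟩⟩⟩
    exact hasColimit_of_iso e.symm

/-- A finite shape may have loops, but finite coproducts and coequalizers have loopless shapes and
generate all finite colimits. -/
theorem hasFiniteColimits_pro [HasFiniteColimits C] : HasFiniteColimits (Pro C) := by
  have h₁ : HasFiniteCoproducts (Pro C) :=
    ⟨fun n => hasColimitsOfShape_of_isLoopless fun _ _ => Subsingleton.elim _ _⟩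
  have h₂ : HasCoequalizers (Pro C) := hasColimitsOfShape_of_isLoopless fun b f => by
    have h : ∀ f : WalkingParallelPairHom b b, f = .id b := by rintro ⟨⟩; rfl
    exact h f
  exact hasFiniteColimits_of_hasCoequalizers_and_finite_coproducts

end FiniteColimits

end ProCategory

theorem theorem6p1 {C : Type u} [Category.{v} C] :
    -- small cofiltered limits exist in pro-`C`
    (∀ (A : Type v) [SmallCategory A] [IsCofiltered A],
      HasLimitsOfShape A (ProCategory.Pro C)) ∧
    -- finite colimits exist in pro-`C` when the relevant colimits exist in `C`
    (HasFiniteColimits C → HasFiniteColimits (ProCategory.Pro C)) ∧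
    (∀ (B : Type w) [SmallCategory B] [FinCategory B], ProCategory.IsLoopless B →
      HasColimitsOfShape B C → HasColimitsOfShape B (ProCategory.Pro C)) ∧
    -- the two commute: if `lim_a colim_b X` exists, so does `colim_b lim_a X`, and the
    -- canonical map is an isomorphism
    (∀ (A : Type v) [SmallCategory A] [IsCofiltered A]
      (B : Type w) [SmallCategory B] [FinCategory B]
      (X : A × B ⥤ ProCategory.Pro C) (P : ProCategory.LimColim X), P.IsUniversal →
        (∃ Q : ProCategory.ColimLim X, Q.IsUniversal) ∧
        ∀ Q : ProCategory.ColimLim X, Q.IsUniversal →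
          ∃ f : Q.cocone.pt ≅ P.cone.pt, ProCategory.IsComparison Q P f.hom) ∧
    -- the same with chosen limits and colimits
    (∀ (A : Type v) [SmallCategory A] [IsCofiltered A]
      (B : Type w) [SmallCategory B] [FinCategory B]
      [HasLimitsOfShape A (ProCategory.Pro C)] [HasColimitsOfShape B (ProCategory.Pro C)]
      (X : A × B ⥤ ProCategory.Pro C), IsIso (colimitLimitToLimitColimit X)) ∧
    -- both are computed by the levelwise colimit of a level representation, which is the
    -- pro-object `(a, s) ↦ colim_b` indexed by `A × I`
    (∀ (A : Type v) [SmallCategory A] [IsCofiltered A]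
      (B : Type w) [SmallCategory B] [FinCategory B]
      (X : A × B ⥤ ProCategory.Pro C) (R : ProCategory.LevelRep X) (K : Cocone R.columns),
      ProCategory.IsLevelwiseColimit K →
        (R.limColim K).IsUniversal ∧ (R.colimLim K).IsUniversal ∧
        ProCategory.IsComparison (R.colimLim K) (R.limColim K)
          (𝟙 ((ProCategory.level (A × R.I)).obj K.pt))) ∧
    -- for `B` loopless a level representation exists after replacing `A` by a cofinite
    -- directed set `A'` along an initial functor, and it computes both for the original `X`
    (∀ (A : Type v) [SmallCategory A] [IsCofiltered A]
      (B : Type w) [SmallCategory B] [FinCategory B], ProCategory.IsLoopless B →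
      ∀ (X : A × B ⥤ ProCategory.Pro C),
        ∃ (A' : Type v) (_ : PartialOrder A') (_ : IsCofiltered A')
          (_ : ∀ a : A', (Set.Ici a).Finite) (T : A' ⥤ A) (_ : T.Initial)
          (R : ProCategory.LevelRep (T.prod (𝟭 B) ⋙ X)),
          ∀ K : Cocone R.columns, ProCategory.IsLevelwiseColimit K →
            (∀ P : ProCategory.LimColim X, P.IsUniversal →
              Nonempty (P.cone.pt ≅ (ProCategory.level (A' × R.I)).obj K.pt)) ∧
            (∀ Q : ProCategory.ColimLim X, Q.IsUniversal →
              Nonempty (Q.cocone.pt ≅ (ProCategory.level (A' × R.I)).obj K.pt))) := by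
  refine ⟨fun A _ _ => inferInstance, fun _ => ProCategory.hasFiniteColimits_pro,
    fun B _ _ hB _ => ProCategory.hasColimitsOfShape_of_isLoopless hB,
    fun A _ _ B _ _ X P hP =>
      ⟨hP.exists_colimLim, fun Q hQ => ProCategory.exists_iso_isComparison hP hQ⟩,
    fun A _ _ B _ _ _ _ X => ProCategory.isIso_colimitLimitToLimitColimit X,
    fun A _ _ B _ _ X R K hK =>
      ⟨R.isUniversal_limColim hK, R.isUniversal_colimLim hK, R.isComparison_id K⟩, ?_⟩
  intro A _ _ B _ _ hB X
  obtain ⟨A', _, hc, hA', T, hT⟩ := ProCategory.exists_initial_of_cofinite A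
  obtain ⟨R⟩ := ProCategory.exists_levelRep_prod hA' hB (T.prod (𝟭 B) ⋙ X)
  refine ⟨A', inferInstance, hc, hA', T, hT, R, fun K hK => ⟨fun P hP => ?_, fun Q hQ => ?_⟩⟩
  -- Restriction along `T` keeps the vertex of `P`, so the comparison over `A'` with the levelwise
  -- `colimLim` identifies it.
  · obtain ⟨f, -⟩ :=
      ProCategory.exists_iso_isComparison (hP.restrict T) (R.isUniversal_colimLim hK)
    exact ⟨f.symm⟩
  · obtain ⟨f, -⟩ :=
      ProCategory.exists_iso_isComparison (R.isUniversal_limColim hK) (hQ.restrict T)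
    exact ⟨f⟩
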